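/- Let $M$ be a smooth $n$-dimensional Riemannian manifold without boundary (second countable) which is complete, i.e. all closed balls of finite radius are compact (for instance, $M$ compact), and let $\mu$ be a smooth positive volume on $M$ (for instance the Riemannian volume). Write $\operatorname{div}$ for the divergence with respect to $\mu$ (in coordinates with $\mu=\sigma\,dy$: $\operatorname{div}X=\sigma^{-1}\sum_i\partial_i(\sigma X^i)$) and $\nabla$ for the Riemannian gradient. For a positive density $\varrho=\rho\mu$ and a function $\theta$ put $$m=\int_M\rho\,\mu,\qquad \xi=\frac1m\int_M\theta\rho\,\mu,\qquad H(\varrho,\theta)=\frac12\int_M|\nabla\theta|^2\rho\,\mu+\frac1{2m}\Big(\int_M\theta\rho\,\mu\Big)^2 .$$ Let $J\subseteq\mathbb R$ be an interval and let $(\rho(t),\theta(t))_{t\in J}$, with $\rho(t)>0$ of class $C^1$ and $\theta(t)$ of class $C^2$ on $M$, be a classical solution of the Hamiltonian geodesic equations $$\dot\rho=-\operatorname{div}(\rho\nabla\theta)+\xi\rho,\qquad \dot\theta=-\tfrac12|\nabla\theta|^2-\xi\theta+\tfrac{\xi^2}{2},$$ such that $\rho$, $\theta\rho$ and $|\nabla\theta|^2\rho$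 are $\mu$-integrable at each time and, locally uniformly in time, $|\partial_t\rho|$ and $|\partial_t(\theta\rho)|$ are bounded by a $\mu$-integrable function on $M$ (if $M$ is compact, this integrability holds as soon as $\rho$, $\theta$ and their first time derivatives are continuous on $J\times M$). Time derivatives at end points of $J$ are one-sided. Then for all $t\in J$ $$\dot\xi=\frac1m\big(H(\varrho,\theta)-m\xi^2\big),\qquad \dot m=m\xi,\qquad\text{and}\qquad \ddot m=H(\varrho,\theta).$$ Moreover the second-order equation is an equivalent form of the system: for any functions $a>0$ and $b$ on $J$ with $\dot a=ab$ on $J$, and with $H(t)=H(\varrho(t),\theta(t))$, one has $\dot b=\frac1a(H-ab^2)$ on $J$ if and only if $\ddot a=H$ on $J$. -/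

import Mathlib

open MeasureTheory Set Filter Topology Bundle
open scoped Manifold ContDiff ENNReal NNReal

noncomputable section

/-- A smooth volume on an `n`-manifold `M`, as a measure: in the chart at every point `p` it is
`density p · dy` with a smooth positive `density p` (the absolute value of the coefficient of the
volume form in that chart). -/
structure SmoothVolume (n : ℕ) (M : Type*) [TopologicalSpace M]
    [ChartedSpace (EuclideanSpace ℝ (Fin n)) M] [MeasurableSpace M] where
  measure : Measure M
  density : M → EuclideanSpace ℝ (Fin n) → ℝ
  contDiffOn_density : ∀ p, ContDiffOn ℝ ∞ (density p) (extChartAt (𝓡 n) p).target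
  density_pos : ∀ p, ∀ y ∈ (extChartAt (𝓡 n) p).target, 0 < density p y
  measure_eq : ∀ p, ∀ A : Set M, MeasurableSet A → A ⊆ (extChartAt (𝓡 n) p).source →
    measure A = ∫⁻ y in extChartAt (𝓡 n) p '' A, ENNReal.ofReal (density p y)

section Geometry

variable {n : ℕ} {M : Type*} [TopologicalSpace M] [ChartedSpace (EuclideanSpace ℝ (Fin n)) M]

/-- The vector field `X` in the coordinates given by the chart at `p`. -/
def coordField (p : M) (X : ∀ x : M, TangentSpace (𝓡 n) x) (y : EuclideanSpace ℝ (Fin n)) :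
    EuclideanSpace ℝ (Fin n) :=
  mfderiv (𝓡 n) 𝓘(ℝ, EuclideanSpace ℝ (Fin n)) (extChartAt (𝓡 n) p)
    ((extChartAt (𝓡 n) p).symm y) (X ((extChartAt (𝓡 n) p).symm y))

/-- The divergence of `X` with respect to the volume `μ = σ dy` at the point `q`, computed in the
chart at `p`: `σ⁻¹ ∑ i, ∂ᵢ (σ Xⁱ)`. -/
def divergence [MeasurableSpace M] (μ : SmoothVolume n M) (p : M)
    (X : ∀ x : M, TangentSpace (𝓡 n) x) (q : M) : ℝ :=
  (μ.density p (extChartAt (𝓡 n) p q))⁻¹ *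
    ∑ i : Fin n, fderiv ℝ (fun y => μ.density p y * coordField p X y i)
      (extChartAt (𝓡 n) p q) (EuclideanSpace.single i 1)

variable [RiemannianBundle (fun x : M => TangentSpace (𝓡 n) x)]

/-- The Riemannian gradient: the vector representing the differential of `f`. -/
def riemGrad (f : M → ℝ) (x : M) : TangentSpace (𝓡 n) x :=
  haveI : FiniteDimensional ℝ (TangentSpace (𝓡 n) x) :=
    inferInstanceAs (FiniteDimensional ℝ (EuclideanSpace ℝ (Fin n)))
  haveI : CompleteSpace (TangentSpace (𝓡 n) x) := FiniteDimensional.complete ℝ _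
  (InnerProductSpace.toDual ℝ (TangentSpace (𝓡 n) x)).symm (mfderiv (𝓡 n) 𝓘(ℝ, ℝ) f x)

theorem inner_riemGrad (f : M → ℝ) (x : M) (v : TangentSpace (𝓡 n) x) :
    inner ℝ (riemGrad f x) v = (mfderiv (𝓡 n) 𝓘(ℝ, ℝ) f x v : ℝ) := by
  have : FiniteDimensional ℝ (TangentSpace (𝓡 n) x) :=
    inferInstanceAs (FiniteDimensional ℝ (EuclideanSpace ℝ (Fin n)))
  have : CompleteSpace (TangentSpace (𝓡 n) x) := FiniteDimensional.complete ℝ _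
  exact InnerProductSpace.toDual_symm_apply

variable [MeasurableSpace M]

/-- The total mass `m = ∫ ρ μ`. -/
def totalMass (μ : SmoothVolume n M) (ρ : M → ℝ) : ℝ :=
  ∫ x, ρ x ∂μ.measure

/-- The variable `ξ = (∫ θ ρ μ) / m`. -/
def xiVar (μ : SmoothVolume n M) (ρ θ : M → ℝ) : ℝ :=
  (∫ x, θ x * ρ x ∂μ.measure) / totalMass μ ρ

/-- The Hamiltonian `H = ½ ∫ |∇θ|² ρ μ + (∫ θ ρ μ)² / (2 m)`. -/
def uotHamiltonian (μ : SmoothVolume n M) (ρ θ : M → ℝ) : ℝ :=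
  (1 / 2) * ∫ x, ‖riemGrad (n := n) θ x‖ ^ 2 * ρ x ∂μ.measure +
    1 / (2 * totalMass μ ρ) * (∫ x, θ x * ρ x ∂μ.measure) ^ 2

/-- `(ρ, θ)` is a classical solution, on the time interval `J`, of the Hamiltonian geodesic
equations `∂ₜρ = -div (ρ ∇θ) + ξ ρ`, `∂ₜθ = -½ |∇θ|² - ξ θ + ½ ξ²`, with finite mass and energy.
At an end point of `J` time derivatives are one-sided. -/
structure IsHamiltonianGeodesic (μ : SmoothVolume n M) (J : Set ℝ) (ρ θ : ℝ → M → ℝ) :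
    Prop where
  contMDiff_rho : ∀ t ∈ J, ContMDiff (𝓡 n) 𝓘(ℝ, ℝ) 1 (ρ t)
  contMDiff_theta : ∀ t ∈ J, ContMDiff (𝓡 n) 𝓘(ℝ, ℝ) 2 (θ t)
  rho_pos : ∀ t ∈ J, ∀ x, 0 < ρ t x
  integrable_rho : ∀ t ∈ J, Integrable (ρ t) μ.measure
  integrable_theta_rho : ∀ t ∈ J, Integrable (fun x => θ t x * ρ t x) μ.measure
  integrable_energy : ∀ t ∈ J,
    Integrable (fun x => ‖riemGrad (n := n) (θ t) x‖ ^ 2 * ρ t x) μ.measure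
  /-- the integrals of `∂ₜρ` and `∂ₜ(θρ)` converge absolutely, locally uniformly in time
  (automatic for `C¹` curves if `M` is compact) -/
  dominated : ∀ t ∈ J, ∃ g : M → ℝ, Integrable g μ.measure ∧ ∀ᶠ s in 𝓝[J] t, ∀ x,
    |derivWithin (fun r => ρ r x) J s| ≤ g x ∧
    |derivWithin (fun r => θ r x * ρ r x) J s| ≤ g x
  /-- the continuity equation, in every chart -/
  rho_eq : ∀ t ∈ J, ∀ p x, x ∈ (extChartAt (𝓡 n) p).source →
    HasDerivWithinAt (fun s => ρ s x)
      (-divergence μ p (fun z => ρ t z • riemGrad (n := n) (θ t) z) x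
        + xiVar μ (ρ t) (θ t) * ρ t x) J t
  theta_eq : ∀ t ∈ J, ∀ x,
    HasDerivWithinAt (fun s => θ s x)
      (-(1 / 2) * ‖riemGrad (n := n) (θ t) x‖ ^ 2 - xiVar μ (ρ t) (θ t) * θ t x
        + xiVar μ (ρ t) (θ t) ^ 2 / 2) J t

end Geometry

end

/-!
Along a geodesic, `m' = ∫ ∂ₜρ` and `(mξ)' = ∫ ∂ₜ(θρ)`. Inserting the equations, everything reduces
to two divergence identities on the complete manifold `M`:

* `∫ div (ρ ∇θ) = 0`, which gives `m' = mξ`;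
* `∫ θ div (ρ ∇θ) = -∫ |∇θ|² ρ`, which gives `(mξ)' = ½ ∫ |∇θ|² ρ + ½ m ξ² = H`.

The remaining claims follow by calculus in one variable.

Both identities come from Gaffney's divergence theorem (`integral_divergence_eq_zero`): if `X` is a
`C¹` vector field and `|X|`, `div X` are integrable, then `∫ div X = 0`. By completeness there are
compactly supported cutoffs `χ` with values in `[0, 1]`, converging to `1`, with Lipschitz constants
`L` converging to `0` (`exists_cutoff`), and `|∫ χ div X| ≤ L ∫ |X|`
(`abs_integral_mul_divergence_le`). The latter is proved in charts with a partition of unity. In a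
chart, a Lipschitz function on `M` is locally Lipschitz, its differential at the points where it
exists is bounded by `L` times the Riemannian norm (`abs_fderiv_comp_extChartAt_symm_le`, by
comparing the distance with the length of coordinate segments), and Rademacher's theorem allows
integration by parts.

The field `ρ ∇θ` has finite total norm by the Cauchy–Schwarz inequality, from finite mass and
energy. The field `θ ρ ∇θ` need not have, so the second identity is proved for bounded truncations
of `θ`, which are then removed by dominated convergence
(`integral_mul_divergence_smul_riemGrad`). The integrability of `div (ρ ∇θ)` and `θ div (ρ ∇θ)` is
read off from the equations and the domination hypothesis, as is the independence of
`div (ρ ∇θ)` of the chart.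
-/

/-! ### Tangent vectors, the metric and the gradient in coordinates -/

section Coordinates

variable {n : ℕ} {M : Type*} [TopologicalSpace M] [ChartedSpace (EuclideanSpace ℝ (Fin n)) M]

/-- The tangent vector at `e.symm y`, where `e` is the chart at `p`, whose coordinates in this
chart are `v`. -/
noncomputable def coordFrame (p : M) (y v : EuclideanSpace ℝ (Fin n)) :
    TangentSpace (𝓡 n) ((extChartAt (𝓡 n) p).symm y) :=
  mfderiv 𝓘(ℝ, EuclideanSpace ℝ (Fin n)) (𝓡 n) (extChartAt (𝓡 n) p).symm y v

theorem coordFrame_add (p : M) (y v w : EuclideanSpace ℝ (Fin n)) :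
    coordFrame p y (v + w) = coordFrame p y v + coordFrame p y w :=
  map_add (mfderiv 𝓘(ℝ, EuclideanSpace ℝ (Fin n)) (𝓡 n) (extChartAt (𝓡 n) p).symm y) v w

theorem coordFrame_smul (p : M) (c : ℝ) (y v : EuclideanSpace ℝ (Fin n)) :
    coordFrame p y (c • v) = c • coordFrame p y v :=
  map_smul (mfderiv 𝓘(ℝ, EuclideanSpace ℝ (Fin n)) (𝓡 n) (extChartAt (𝓡 n) p).symm y) c v

theorem coordField_smul (p : M) (f : M → ℝ) (X : ∀ x : M, TangentSpace (𝓡 n) x)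
    (y : EuclideanSpace ℝ (Fin n)) :
    coordField p (fun z => f z • X z) y =
      f ((extChartAt (𝓡 n) p).symm y) • coordField p X y :=
  map_smul (mfderiv (𝓡 n) 𝓘(ℝ, EuclideanSpace ℝ (Fin n)) (extChartAt (𝓡 n) p)
    ((extChartAt (𝓡 n) p).symm y)) _ _

variable [IsManifold (𝓡 n) 1 M]

theorem mfderiv_extChartAt_coordFrame {p : M} {y : EuclideanSpace ℝ (Fin n)}
    (hy : y ∈ (extChartAt (𝓡 n) p).target) (v : EuclideanSpace ℝ (Fin n)) :
    mfderiv (𝓡 n) 𝓘(ℝ, EuclideanSpace ℝ (Fin n)) (extChartAt (𝓡 n) p)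
      ((extChartAt (𝓡 n) p).symm y) (coordFrame p y v) = v := by
  have := mfderiv_extChartAt_comp_mfderivWithin_extChartAt_symm (I := 𝓡 n) hy
  rw [ModelWithCorners.range_eq_univ, mfderivWithin_univ] at this
  exact DFunLike.congr_fun this v

theorem coordFrame_mfderiv_extChartAt {p : M} {y : EuclideanSpace ℝ (Fin n)}
    (hy : y ∈ (extChartAt (𝓡 n) p).target)
    (w : TangentSpace (𝓡 n) ((extChartAt (𝓡 n) p).symm y)) :
    coordFrame p y (mfderiv (𝓡 n) 𝓘(ℝ, EuclideanSpace ℝ (Fin n)) (extChartAt (𝓡 n) p)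
      ((extChartAt (𝓡 n) p).symm y) w) = w := by
  have := mfderivWithin_extChartAt_symm_comp_mfderiv_extChartAt (I := 𝓡 n) hy
  rw [ModelWithCorners.range_eq_univ, mfderivWithin_univ] at this
  exact DFunLike.congr_fun this w

theorem coordFrame_coordField {p : M} {y : EuclideanSpace ℝ (Fin n)}
    (hy : y ∈ (extChartAt (𝓡 n) p).target) (X : ∀ x : M, TangentSpace (𝓡 n) x) :
    coordFrame p y (coordField p X y) = X ((extChartAt (𝓡 n) p).symm y) :=
  coordFrame_mfderiv_extChartAt hy _

theorem fderiv_comp_extChartAt_symm {p : M} {y : EuclideanSpace ℝ (Fin n)}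
    (hy : y ∈ (extChartAt (𝓡 n) p).target) {f : M → ℝ}
    (hf : MDifferentiableAt (𝓡 n) 𝓘(ℝ, ℝ) f ((extChartAt (𝓡 n) p).symm y))
    (v : EuclideanSpace ℝ (Fin n)) :
    fderiv ℝ (fun z => f ((extChartAt (𝓡 n) p).symm z)) y v =
      (mfderiv (𝓡 n) 𝓘(ℝ, ℝ) f ((extChartAt (𝓡 n) p).symm y) (coordFrame p y v) : ℝ) := by
  have h1 : MDifferentiableAt 𝓘(ℝ, EuclideanSpace ℝ (Fin n)) (𝓡 n)
      (extChartAt (𝓡 n) p).symm y := by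
    have := mdifferentiableWithinAt_extChartAt_symm (I := 𝓡 n) hy
    rwa [ModelWithCorners.range_eq_univ, mdifferentiableWithinAt_univ] at this
  have := mfderiv_comp y hf h1
  rw [mfderiv_eq_fderiv] at this
  exact DFunLike.congr_fun this v

theorem contDiffOn_comp_extChartAt_symm (p : M) {f : M → ℝ}
    (hf : ContMDiff (𝓡 n) 𝓘(ℝ, ℝ) 1 f) :
    ContDiffOn ℝ 1 (fun z => f ((extChartAt (𝓡 n) p).symm z)) (extChartAt (𝓡 n) p).target :=
  (hf.comp_contMDiffOn (contMDiffOn_extChartAt_symm p)).contDiffOn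

end Coordinates

/-- Vector fields with constant coordinates in a chart are smooth. -/
theorem contMDiffOn_coordFrame {n : ℕ} {M : Type*} [TopologicalSpace M]
    [ChartedSpace (EuclideanSpace ℝ (Fin n)) M] [IsManifold (𝓡 n) ∞ M]
    (p : M) (v : EuclideanSpace ℝ (Fin n)) :
    ContMDiffOn 𝓘(ℝ, EuclideanSpace ℝ (Fin n)) ((𝓡 n).prod 𝓘(ℝ, EuclideanSpace ℝ (Fin n))) ∞
      (fun y => (⟨(extChartAt (𝓡 n) p).symm y, coordFrame p y v⟩ : TangentBundle (𝓡 n) M))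
      (extChartAt (𝓡 n) p).target := by
  have hop : IsOpen (extChartAt (𝓡 n) p).target := isOpen_extChartAt_target p
  have h1 : ContMDiffOn 𝓘(ℝ, EuclideanSpace ℝ (Fin n)) (𝓡 n) ∞ (extChartAt (𝓡 n) p).symm
    (extChartAt (𝓡 n) p).target := contMDiffOn_extChartAt_symm p
  have h2 := h1.contMDiffOn_tangentMapWithin (m := ∞) (by simp) hop.uniqueMDiffOn
  have h3 := contMDiff_vectorSpace_iff_contDiff.2
    (contDiff_const : ContDiff ℝ ∞ (fun _ : EuclideanSpace ℝ (Fin n) => v))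
  refine (h2.comp h3.contMDiffOn (fun y hy => hy)).congr (fun y hy => ?_)
  simp only [Function.comp_apply, tangentMapWithin, coordFrame]
  rw [mfderivWithin_of_isOpen hop hy]

section Metric

variable {n : ℕ} {M : Type*} [TopologicalSpace M] [ChartedSpace (EuclideanSpace ℝ (Fin n)) M]
  [RiemannianBundle (fun x : M => TangentSpace (𝓡 n) x)]

/-- The metric tensor in the chart at `p`, as a bilinear form on coordinate vectors. -/
noncomputable def coordMetric (p : M) (y : EuclideanSpace ℝ (Fin n)) :
    EuclideanSpace ℝ (Fin n) →L[ℝ] EuclideanSpace ℝ (Fin n) →L[ℝ] ℝ :=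
  LinearMap.toContinuousLinearMap
    { toFun := fun v => LinearMap.toContinuousLinearMap
        { toFun := fun w => inner ℝ (coordFrame p y v) (coordFrame p y w)
          map_add' := fun w w' => by rw [coordFrame_add, inner_add_right]
          map_smul' := fun c w => by rw [coordFrame_smul, inner_smul_right]; rfl }
      map_add' := fun v v' => by
        ext w
        change inner ℝ (coordFrame p y (v + v')) (coordFrame p y w) = _
        rw [coordFrame_add, inner_add_left]; rfl
      map_smul' := fun c v => by
        ext w
        change inner ℝ (coordFrame p y (c • v)) (coordFrame p y w) = _
        rw [coordFrame_smul, real_inner_smul_left]; rfl }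

theorem coordMetric_apply (p : M) (y v w : EuclideanSpace ℝ (Fin n)) :
    coordMetric p y v w = inner ℝ (coordFrame p y v) (coordFrame p y w) := rfl

theorem coordMetric_self (p : M) (y v : EuclideanSpace ℝ (Fin n)) :
    coordMetric p y v v = ‖coordFrame p y v‖ ^ 2 := by
  rw [coordMetric_apply, real_inner_self_eq_norm_sq]

variable [IsManifold (𝓡 n) ∞ M]

/-- The metric tensor is an isomorphism between vectors and covectors. -/
theorem exists_equiv_coordMetric {p : M} {y : EuclideanSpace ℝ (Fin n)}
    (hy : y ∈ (extChartAt (𝓡 n) p).target) :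
    ∃ L : EuclideanSpace ℝ (Fin n) ≃L[ℝ] (EuclideanSpace ℝ (Fin n) →L[ℝ] ℝ),
      (L : EuclideanSpace ℝ (Fin n) →L[ℝ] (EuclideanSpace ℝ (Fin n) →L[ℝ] ℝ)) =
        coordMetric p y := by
  have hinj : Function.Injective (coordMetric p y).toLinearMap := by
    rw [injective_iff_map_eq_zero]
    intro v hv
    have h0 : coordMetric p y v v = 0 := by
      have : coordMetric p y v = 0 := hv
      rw [this]; rfl
    rw [coordMetric_self] at h0
    have h1 : coordFrame p y v = 0 := norm_eq_zero.1 (pow_eq_zero_iff two_ne_zero |>.1 h0)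
    rw [← mfderiv_extChartAt_coordFrame hy v, h1]
    exact map_zero _
  have hdim : Module.finrank ℝ (EuclideanSpace ℝ (Fin n)) =
      Module.finrank ℝ (EuclideanSpace ℝ (Fin n) →L[ℝ] ℝ) := by
    rw [(InnerProductSpace.toDual ℝ (EuclideanSpace ℝ (Fin n))).toLinearEquiv.finrank_eq]
  refine ⟨(LinearEquiv.ofInjectiveOfFinrankEq _ hinj hdim).toContinuousLinearEquiv, ?_⟩
  ext v w
  rfl

theorem coordMetric_coordField_riemGrad {p : M} {y : EuclideanSpace ℝ (Fin n)}
    (hy : y ∈ (extChartAt (𝓡 n) p).target) {f : M → ℝ}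
    (hf : MDifferentiableAt (𝓡 n) 𝓘(ℝ, ℝ) f ((extChartAt (𝓡 n) p).symm y)) :
    coordMetric p y (coordField p (riemGrad (n := n) f) y) =
      fderiv ℝ (fun z => f ((extChartAt (𝓡 n) p).symm z)) y := by
  ext v
  rw [coordMetric_apply, coordFrame_coordField hy, inner_riemGrad,
    fderiv_comp_extChartAt_symm hy hf]

variable [IsContMDiffRiemannianBundle (𝓡 n) ∞ (EuclideanSpace ℝ (Fin n))
      (fun x : M => TangentSpace (𝓡 n) x)]

theorem contDiffOn_inner_coordFrame (p : M) (v w : EuclideanSpace ℝ (Fin n)) :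
    ContDiffOn ℝ ∞ (fun y => inner ℝ (coordFrame p y v) (coordFrame p y w))
      (extChartAt (𝓡 n) p).target :=
  (ContMDiffOn.inner_bundle (contMDiffOn_coordFrame p v) (contMDiffOn_coordFrame p w)).contDiffOn

theorem contDiffOn_coordMetric (p : M) :
    ContDiffOn ℝ ∞ (coordMetric (n := n) p) (extChartAt (𝓡 n) p).target := by
  rw [contDiffOn_clm_apply]
  intro v
  rw [contDiffOn_clm_apply]
  exact fun w => contDiffOn_inner_coordFrame p v w

/-- The gradient of a `C²` function is `C¹`: in coordinates it is the differential multiplied by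
the inverse of the metric tensor. -/
theorem contDiffOn_coordField_riemGrad (p : M) {f : M → ℝ}
    (hf : ContMDiff (𝓡 n) 𝓘(ℝ, ℝ) 2 f) :
    ContDiffOn ℝ 1 (coordField p (riemGrad (n := n) f)) (extChartAt (𝓡 n) p).target := by
  have hop : IsOpen (extChartAt (𝓡 n) p).target := isOpen_extChartAt_target p
  have hd : ContDiffOn ℝ 1 (fderiv ℝ (fun z => f ((extChartAt (𝓡 n) p).symm z)))
      (extChartAt (𝓡 n) p).target := by
    have h2 : ContDiffOn ℝ 2 (fun z => f ((extChartAt (𝓡 n) p).symm z))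
        (extChartAt (𝓡 n) p).target :=
      (hf.comp_contMDiffOn (contMDiffOn_extChartAt_symm p)).contDiffOn
    exact h2.fderiv_of_isOpen hop (by norm_num)
  have hinv : ContDiffOn ℝ 1 (fun y => (coordMetric (n := n) p y).inverse)
      (extChartAt (𝓡 n) p).target := by
    intro y hy
    obtain ⟨L, hL⟩ := exists_equiv_coordMetric hy
    have h1 : ContDiffAt ℝ 1 ContinuousLinearMap.inverse (coordMetric p y) := by
      rw [← hL]; exact contDiffAt_map_inverse L
    exact h1.comp_contDiffWithinAt y
      ((contDiffOn_coordMetric p y hy).of_le (by exact_mod_cast le_top))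
  refine (hinv.clm_apply hd).congr (fun y hy => ?_)
  rw [← coordMetric_coordField_riemGrad hy (hf.mdifferentiable (by norm_num) _)]
  obtain ⟨L, hL⟩ := exists_equiv_coordMetric hy
  rw [← hL, ContinuousLinearMap.inverse_equiv]
  simp

end Metric

/-! ### Distance and Lipschitz functions in coordinates -/

theorem continuousOn_norm_coordFrame {n : ℕ} {M : Type*} [TopologicalSpace M]
    [ChartedSpace (EuclideanSpace ℝ (Fin n)) M] [IsManifold (𝓡 n) ∞ M]
    [RiemannianBundle (fun x : M => TangentSpace (𝓡 n) x)]
    [IsContMDiffRiemannianBundle (𝓡 n) ∞ (EuclideanSpace ℝ (Fin n))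
      (fun x : M => TangentSpace (𝓡 n) x)] (p : M) (v : EuclideanSpace ℝ (Fin n)) :
    ContinuousOn (fun y => ‖coordFrame p y v‖) (extChartAt (𝓡 n) p).target := by
  have h := (contDiffOn_inner_coordFrame p v v).continuousOn.sqrt
  refine h.congr (fun y _ => ?_)
  change _ = √(inner ℝ (coordFrame p y v) (coordFrame p y v))
  rw [real_inner_self_eq_norm_sq, Real.sqrt_sq (norm_nonneg _)]

/-- A continuous family of bilinear forms is locally uniformly bounded. -/
theorem exists_bound_quadratic {X F : Type*} [TopologicalSpace X] [NormedAddCommGroup F]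
    [NormedSpace ℝ F] {G : X → F →L[ℝ] F →L[ℝ] ℝ} {y : X} (hG : ContinuousAt G y) :
    ∃ B : ℝ, 0 ≤ B ∧ ∀ᶠ z in 𝓝 y, ∀ v, G z v v ≤ B * ‖v‖ ^ 2 := by
  let _ : SeminormedAddCommGroup (F →L[ℝ] F →L[ℝ] ℝ) :=
    ContinuousLinearMap.toSeminormedAddCommGroup
  let _ : SeminormedAddGroup (F →L[ℝ] F →L[ℝ] ℝ) := SeminormedAddCommGroup.toSeminormedAddGroup
  obtain ⟨B, hB⟩ : ∃ B : ℝ, ‖G y‖ < B := exists_gt _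
  refine ⟨B, (norm_nonneg _).trans hB.le, ?_⟩
  filter_upwards [hG.norm.eventually_lt continuousAt_const hB] with z hz v
  calc G z v v ≤ ‖G z v v‖ := Real.le_norm_self _
    _ ≤ ‖G z‖ * ‖v‖ * ‖v‖ := (G z).le_opNorm₂ v v
    _ ≤ B * ‖v‖ * ‖v‖ := by gcongr
    _ = B * ‖v‖ ^ 2 := by ring

theorem exists_norm_coordFrame_le {n : ℕ} {M : Type*} [TopologicalSpace M]
    [ChartedSpace (EuclideanSpace ℝ (Fin n)) M] [IsManifold (𝓡 n) ∞ M]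
    [RiemannianBundle (fun x : M => TangentSpace (𝓡 n) x)]
    [IsContMDiffRiemannianBundle (𝓡 n) ∞ (EuclideanSpace ℝ (Fin n))
      (fun x : M => TangentSpace (𝓡 n) x)] {p : M} {y : EuclideanSpace ℝ (Fin n)}
    (hy : y ∈ (extChartAt (𝓡 n) p).target) :
    ∃ C : ℝ≥0, ∀ᶠ z in 𝓝 y, ∀ v, ‖coordFrame p z v‖ ≤ C * ‖v‖ := by
  have hop : IsOpen (extChartAt (𝓡 n) p).target := isOpen_extChartAt_target p
  obtain ⟨B, hB0, hB⟩ := exists_bound_quadratic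
    ((contDiffOn_coordMetric p).continuousOn.continuousAt (hop.mem_nhds hy))
  refine ⟨(√B).toNNReal, hB.mono fun z hz v => ?_⟩
  rw [Real.coe_toNNReal _ (Real.sqrt_nonneg B)]
  refine le_of_sq_le_sq ?_ (by positivity)
  rw [mul_pow, Real.sq_sqrt hB0, ← coordMetric_self]
  exact hz v

section Distance

variable {n : ℕ} {M : Type*} [EMetricSpace M]
    [ChartedSpace (EuclideanSpace ℝ (Fin n)) M] [IsManifold (𝓡 n) ∞ M]
    [RiemannianBundle (fun x : M => TangentSpace (𝓡 n) x)]
    [IsRiemannianManifold (𝓡 n) M]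

/-- The distance between the end points of a coordinate segment is at most its length. -/
theorem edist_extChartAt_symm_le {p : M} {y v : EuclideanSpace ℝ (Fin n)} {c : ℝ≥0}
    (hT : ∀ s ∈ Icc (0 : ℝ) 1, y + s • v ∈ (extChartAt (𝓡 n) p).target)
    (hc : ∀ s ∈ Icc (0 : ℝ) 1, ‖coordFrame p (y + s • v) v‖ ≤ c) :
    edist ((extChartAt (𝓡 n) p).symm y) ((extChartAt (𝓡 n) p).symm (y + v)) ≤ c := by
  have hop : IsOpen (extChartAt (𝓡 n) p).target := isOpen_extChartAt_target p
  have hl : ContDiff ℝ 1 (fun s : ℝ => y + s • v) := by fun_prop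
  have hS : ContMDiffOn 𝓘(ℝ, EuclideanSpace ℝ (Fin n)) (𝓡 n) 1 (extChartAt (𝓡 n) p).symm
    (extChartAt (𝓡 n) p).target := contMDiffOn_extChartAt_symm p
  have hγ : ContMDiffOn 𝓘(ℝ, ℝ) (𝓡 n) 1
      ((extChartAt (𝓡 n) p).symm ∘ (fun s : ℝ => y + s • v)) (Icc 0 1) :=
    hS.comp hl.contMDiff.contMDiffOn hT
  rw [IsRiemannianManifold.out (I := 𝓡 n)]
  refine (Manifold.riemannianEDist_le_pathELength hγ (by simp) (by simp) zero_le_one).trans ?_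
  rw [Manifold.pathELength_eq_lintegral_mfderiv_Icc]
  have hbd : ∀ s ∈ Icc (0 : ℝ) 1, ‖mfderiv 𝓘(ℝ, ℝ) (𝓡 n)
      ((extChartAt (𝓡 n) p).symm ∘ (fun s : ℝ => y + s • v)) s 1‖ₑ ≤ (c : ℝ≥0∞) := by
    intro s hs
    have h1 : MDifferentiableAt 𝓘(ℝ, EuclideanSpace ℝ (Fin n)) (𝓡 n)
        (extChartAt (𝓡 n) p).symm (y + s • v) :=
      (hS.contMDiffAt (hop.mem_nhds (hT s hs))).mdifferentiableAt (by norm_num)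
    have h2 : HasFDerivAt (fun s : ℝ => y + s • v)
        (ContinuousLinearMap.toSpanSingleton ℝ v) s := by
      have := ((hasDerivAt_id s).smul_const v).const_add y
      simpa using this.hasFDerivAt
    have h3 := mfderiv_comp s h1 h2.hasMFDerivAt.mdifferentiableAt
    rw [h2.hasMFDerivAt.mfderiv] at h3
    have h4 : mfderiv 𝓘(ℝ, ℝ) (𝓡 n)
        ((extChartAt (𝓡 n) p).symm ∘ (fun s : ℝ => y + s • v)) s 1 =
        coordFrame p (y + s • v) v := by
      refine (DFunLike.congr_fun h3 (1 : ℝ)).trans ?_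
      change mfderiv 𝓘(ℝ, EuclideanSpace ℝ (Fin n)) (𝓡 n) (extChartAt (𝓡 n) p).symm (y + s • v)
        ((1 : ℝ) • v) = _
      rw [one_smul]; rfl
    have h5 := hc s hs
    rw [← h4] at h5
    rw [enorm_eq_nnnorm]
    exact_mod_cast h5
  refine (setLIntegral_mono' measurableSet_Icc hbd).trans ?_
  simp

variable [IsContMDiffRiemannianBundle (𝓡 n) ∞ (EuclideanSpace ℝ (Fin n))
      (fun x : M => TangentSpace (𝓡 n) x)]

/-- Inverse charts are locally Lipschitz. -/
theorem locallyLipschitzOn_extChartAt_symm (p : M) :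
    LocallyLipschitzOn (extChartAt (𝓡 n) p).target (extChartAt (𝓡 n) p).symm := by
  intro y hy
  have hop : IsOpen (extChartAt (𝓡 n) p).target := isOpen_extChartAt_target p
  obtain ⟨C, hC⟩ := exists_norm_coordFrame_le hy
  obtain ⟨r, hr, hball⟩ := Metric.mem_nhds_iff.1 (hC.and (hop.mem_nhds hy))
  refine ⟨C, Metric.ball y r, mem_nhdsWithin_of_mem_nhds (Metric.ball_mem_nhds y hr), ?_⟩
  intro a ha b hb
  have hseg : ∀ s ∈ Icc (0 : ℝ) 1, a + s • (b - a) ∈ Metric.ball y r := fun s hs =>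
    (convex_ball y r).add_smul_sub_mem ha hb hs
  have := edist_extChartAt_symm_le (p := p) (y := a) (v := b - a) (c := C * ‖b - a‖₊)
    (fun s hs => (hball (hseg s hs)).2) (fun s hs => (hball (hseg s hs)).1 _)
  rw [add_sub_cancel] at this
  refine this.trans (le_of_eq ?_)
  rw [edist_comm, edist_eq_enorm_sub, enorm_eq_nnnorm]
  push_cast; rfl

/-- In a chart, the differential of an `L`-Lipschitz function is bounded by `L` times the
Riemannian norm. -/
theorem abs_fderiv_comp_extChartAt_symm_le {p : M} {y : EuclideanSpace ℝ (Fin n)}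
    (hy : y ∈ (extChartAt (𝓡 n) p).target) {χ : M → ℝ} {L : ℝ≥0} (hχ : LipschitzWith L χ)
    (hd : DifferentiableAt ℝ (fun z => χ ((extChartAt (𝓡 n) p).symm z)) y)
    (v : EuclideanSpace ℝ (Fin n)) :
    |fderiv ℝ (fun z => χ ((extChartAt (𝓡 n) p).symm z)) y v| ≤ L * ‖coordFrame p y v‖ := by
  have hop : IsOpen (extChartAt (𝓡 n) p).target := isOpen_extChartAt_target p
  -- It suffices to bound the directional derivative by every `b > L ‖coordFrame p y v‖`. Choose `c`
  -- with `‖coordFrame p y v‖ < c` and `L c ≤ b`: by continuity of the metric, the segments in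
  -- direction `v` have speed below `c` near `y`.
  refine le_of_forall_gt_imp_ge_of_dense (fun b hb => ?_)
  obtain ⟨c, hc1, hc2⟩ : ∃ c : ℝ, ‖coordFrame p y v‖ < c ∧ L * c ≤ b := by
    rcases eq_or_ne L 0 with rfl | hL
    · exact ⟨‖coordFrame p y v‖ + 1, by linarith, by simpa using (by simpa using hb : 0 < b).le⟩
    · have hL' : (0 : ℝ) < L := by positivity
      exact ⟨b / L, by rwa [lt_div_iff₀' hL'], by rw [mul_div_cancel₀ _ hL'.ne']⟩
  have hc0 : 0 ≤ c := (norm_nonneg _).trans hc1.le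
  have hev : ∀ᶠ z in 𝓝 y, z ∈ (extChartAt (𝓡 n) p).target ∧ ‖coordFrame p z v‖ < c :=
    (hop.eventually_mem hy).and
      (((continuousOn_norm_coordFrame p v).continuousAt (hop.mem_nhds hy)).eventually_lt
        continuousAt_const hc1)
  obtain ⟨r, hr, hball⟩ := Metric.mem_nhds_iff.1 hev
  have hline : Tendsto (fun t : ℝ => y + t • v) (𝓝[>] 0) (𝓝 y) := by
    have : Continuous (fun t : ℝ => y + t • v) := by fun_prop
    have h2 := this.tendsto 0
    simp only [zero_smul, add_zero] at h2
    exact h2.mono_left nhdsWithin_le_nhds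
  have hlim : Tendsto (fun t : ℝ => |t⁻¹ • (χ ((extChartAt (𝓡 n) p).symm (y + t • v)) -
      χ ((extChartAt (𝓡 n) p).symm y))|) (𝓝[>] 0)
      (𝓝 |fderiv ℝ (fun z => χ ((extChartAt (𝓡 n) p).symm z)) y v|) := by
    have := hd.hasFDerivAt.hasLineDerivAt v
    exact (this.tendsto_slope_zero_right).abs
  refine le_trans (le_of_tendsto hlim ?_) hc2
  filter_upwards [hline (Metric.ball_mem_nhds y hr), self_mem_nhdsWithin] with t ht ht0
  have ht0 : 0 < t := ht0
  have hseg : ∀ s ∈ Icc (0 : ℝ) 1, y + s • (t • v) ∈ Metric.ball y r := fun s hs =>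
    (convex_ball y r).add_smul_mem (Metric.mem_ball_self hr) ht hs
  have h1 := edist_extChartAt_symm_le (p := p) (y := y) (v := t • v) (c := (t * c).toNNReal)
    (fun s hs => (hball (hseg s hs)).1) (fun s hs => by
      rw [coordFrame_smul, norm_smul, Real.coe_toNNReal _ (by positivity),
        Real.norm_of_nonneg ht0.le]
      exact mul_le_mul_of_nonneg_left (hball (hseg s hs)).2.le ht0.le)
  have h2 := (hχ ((extChartAt (𝓡 n) p).symm y) ((extChartAt (𝓡 n) p).symm (y + t • v))).trans
    (mul_le_mul_right h1 (L : ℝ≥0∞))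
  rw [edist_nndist, ← ENNReal.coe_mul, ENNReal.coe_le_coe, ← NNReal.coe_le_coe, coe_nndist,
    NNReal.coe_mul, dist_comm, Real.dist_eq, Real.coe_toNNReal _ (by positivity)] at h2
  rw [smul_eq_mul, abs_mul, abs_of_pos (inv_pos.2 ht0), inv_mul_le_iff₀ ht0]
  linarith

end Distance

/-! ### Integration by parts in a chart and change of variables -/

section Euclidean

variable {n : ℕ}

/-- A function that is `C¹` on an open set and vanishes off a compact subset of it is `C¹`. -/
theorem contDiff_of_contDiffOn_of_eq_zero {E F : Type*} [NormedAddCommGroup E] [NormedSpace ℝ E]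
    [NormedAddCommGroup F] [NormedSpace ℝ F] {T K : Set E} {G : E → F} (hT : IsOpen T)
    (hG : ContDiffOn ℝ 1 G T) (hK : IsClosed K) (hKT : K ⊆ T) (h0 : ∀ y ∉ K, G y = 0) :
    ContDiff ℝ 1 G := by
  rw [contDiff_iff_contDiffAt]
  intro y
  by_cases hy : y ∈ T
  · exact hG.contDiffAt (hT.mem_nhds hy)
  · have : G =ᶠ[𝓝 y] fun _ => 0 := by
      filter_upwards [hK.isOpen_compl.mem_nhds (fun h => hy (hKT h))] with z hz using h0 z hz
    exact contDiffAt_const.congr_of_eventuallyEq this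

/-- Integration by parts of a locally Lipschitz function `f` against a compactly supported `C¹`
vector field `G`, in the form of an inequality. By Rademacher's theorem, `f` is differentiable
almost everywhere; a bound `N` for `|df(G)|` at the points of differentiability is enough. -/
theorem abs_integral_mul_sum_fderiv_le {T K : Set (EuclideanSpace ℝ (Fin n))} (hT : IsOpen T)
    (hK : IsCompact K) (hKT : K ⊆ T) {f : EuclideanSpace ℝ (Fin n) → ℝ}
    (hf : LocallyLipschitzOn T f)
    {G : EuclideanSpace ℝ (Fin n) → EuclideanSpace ℝ (Fin n)} (hG : ContDiff ℝ 1 G)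
    (h0 : ∀ y ∉ K, G y = 0) {N : EuclideanSpace ℝ (Fin n) → ℝ} (hN : Integrable N)
    (hN0 : ∀ y, 0 ≤ N y)
    (hfN : ∀ y ∈ T, DifferentiableAt ℝ f y → |fderiv ℝ f y (G y)| ≤ N y) :
    |∫ y, f y * ∑ i, fderiv ℝ (fun z => G z i) y (EuclideanSpace.single i 1)| ≤ ∫ y, N y := by
  obtain ⟨K', hK', hKK', hK'T⟩ := exists_compact_between hK hT hKT
  obtain ⟨C, hC⟩ := LocallyLipschitzOn.exists_lipschitzOnWith_of_compact hK' (hf.mono hK'T)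
  obtain ⟨g, hg, hfg⟩ := hC.extend_real
  have hGi : ∀ i, ContDiff ℝ 1 (fun z => G z i) := fun i => by fun_prop
  have hsupp : ∀ i, HasCompactSupport (fun z => G z i) := fun i =>
    HasCompactSupport.intro hK (fun y hy => by simp [h0 y hy])
  have hfd0 : ∀ i, ∀ y ∉ K, fderiv ℝ (fun z => G z i) y = 0 := by
    intro i y hy
    have : (fun z => G z i) =ᶠ[𝓝 y] fun _ => 0 := by
      filter_upwards [hK.isClosed.isOpen_compl.mem_nhds hy] with z hz
      simp [h0 z hz]
    rw [this.fderiv_eq, fderiv_fun_const]; rfl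
  -- replace `f` by its global Lipschitz extension `g`
  have e1 : ∫ y, f y * ∑ i, fderiv ℝ (fun z => G z i) y (EuclideanSpace.single i 1) =
      ∫ y, ∑ i, lineDeriv ℝ (fun z => G z i) y (EuclideanSpace.single i 1) * g y := by
    refine integral_congr_ae (Eventually.of_forall fun y => ?_)
    simp only [((hGi _).differentiable (by norm_num) y).lineDeriv_eq_fderiv]
    rw [Finset.mul_sum]
    refine Finset.sum_congr rfl fun i _ => ?_
    by_cases hy : y ∈ K
    · rw [hfg (interior_subset (hKK' hy)), mul_comm]
    · simp [hfd0 i y hy]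
  have hcs : ∀ i, Integrable
      (fun y => lineDeriv ℝ (fun z => G z i) y (EuclideanSpace.single i 1) * g y) := by
    intro i
    have hc : Continuous (fun y => fderiv ℝ (fun z => G z i) y (EuclideanSpace.single i 1)) :=
      ((hGi i).continuous_fderiv (by norm_num)).clm_apply continuous_const
    have : (fun y => lineDeriv ℝ (fun z => G z i) y (EuclideanSpace.single i 1) * g y) =
        fun y => fderiv ℝ (fun z => G z i) y (EuclideanSpace.single i 1) * g y := by
      ext y; rw [((hGi i).differentiable (by norm_num) y).lineDeriv_eq_fderiv]
    rw [this]
    exact (hc.mul hg.continuous).integrable_of_hasCompactSupport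
      (HasCompactSupport.intro hK (fun y hy => by simp [hfd0 i y hy]))
  have hci : ∀ i, Integrable
      (fun y => lineDeriv ℝ g y (EuclideanSpace.single i (1 : ℝ)) * G y i) := by
    intro i
    exact ((hGi i).continuous.integrable_of_hasCompactSupport (hsupp i)).bdd_mul
      (c := C * ‖(EuclideanSpace.single i (1 : ℝ) : EuclideanSpace ℝ (Fin n))‖)
      (aestronglyMeasurable_lineDeriv hg.continuous volume)
      (.of_forall fun x => norm_lineDeriv_le_of_lipschitz ℝ hg)
  have e2 : ∫ y, ∑ i, lineDeriv ℝ (fun z => G z i) y (EuclideanSpace.single i 1) * g y =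
      - ∫ y, ∑ i, lineDeriv ℝ g y (EuclideanSpace.single i (1 : ℝ)) * G y i := by
    rw [integral_finsetSum _ (fun i _ => hcs i), integral_finsetSum _ (fun i _ => hci i),
      ← Finset.sum_neg_distrib]
    refine Finset.sum_congr rfl fun i _ => ?_
    obtain ⟨D, hD⟩ := ContDiff.lipschitzWith_of_hasCompactSupport (hsupp i) (hGi i) (by norm_num)
    rw [hg.integral_lineDeriv_mul_eq hD (hsupp i), ← integral_neg]
    refine integral_congr_ae (Eventually.of_forall fun y => ?_)
    simp only [((hGi _).differentiable (by norm_num) y).lineDeriv_eq_fderiv, map_neg, neg_mul,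
      neg_neg]
  rw [e1, e2, abs_neg, ← Real.norm_eq_abs]
  refine norm_integral_le_of_norm_le hN ?_
  filter_upwards [hg.ae_differentiableAt (μ := volume)] with y hy
  by_cases hyK : y ∈ K
  · have hev : g =ᶠ[𝓝 y] f := by
      filter_upwards [isOpen_interior.mem_nhds (hKK' hyK)] with z hz
      exact (hfg (interior_subset hz)).symm
    have hsum : ∑ i, lineDeriv ℝ g y (EuclideanSpace.single i (1 : ℝ)) * G y i =
        fderiv ℝ f y (G y) := by
      rw [← hev.fderiv_eq]
      conv_rhs => rw [← (EuclideanSpace.basisFun (Fin n) ℝ).sum_repr (G y)]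
      rw [map_sum]
      refine Finset.sum_congr rfl fun i _ => ?_
      rw [hy.lineDeriv_eq_fderiv, map_smul, smul_eq_mul, mul_comm]
      simp
    rw [hsum]
    exact hfN y (hKT hyK) (hev.differentiableAt_iff.1 hy)
  · simpa [h0 y hyK] using hN0 y

end Euclidean

section ChangeOfVariables

variable {n : ℕ} {M : Type*} [TopologicalSpace M] [ChartedSpace (EuclideanSpace ℝ (Fin n)) M]
  [MeasurableSpace M]

theorem aemeasurable_density (μ : SmoothVolume n M) (p : M) :
    AEMeasurable (fun y => ENNReal.ofReal (μ.density p y))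
      (volume.restrict (extChartAt (𝓡 n) p).target) :=
  ((μ.contDiffOn_density p).continuousOn.aemeasurable
    (isOpen_extChartAt_target p).measurableSet).ennreal_ofReal

theorem toReal_ofReal_density_ae (μ : SmoothVolume n M) (p : M) (F : M → ℝ) :
    (fun y => (ENNReal.ofReal (μ.density p y)).toReal • F ((extChartAt (𝓡 n) p).symm y))
      =ᵐ[volume.restrict (extChartAt (𝓡 n) p).target]
    (fun y => μ.density p y * F ((extChartAt (𝓡 n) p).symm y)) := by
  filter_upwards [ae_restrict_mem (isOpen_extChartAt_target p).measurableSet] with y hy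
  rw [ENNReal.toReal_ofReal (μ.density_pos p y hy).le, smul_eq_mul]

variable [BorelSpace M]

theorem aemeasurable_extChartAt_symm (p : M) :
    AEMeasurable (extChartAt (𝓡 n) p).symm (volume.restrict (extChartAt (𝓡 n) p).target) :=
  (continuousOn_extChartAt_symm p).aemeasurable (isOpen_extChartAt_target p).measurableSet

/-- On a chart domain, a smooth volume is the image of `σ dy` under the inverse chart. -/
theorem restrict_measure_eq_map (μ : SmoothVolume n M) (p : M) :
    μ.measure.restrict (extChartAt (𝓡 n) p).source =
      ((volume.restrict (extChartAt (𝓡 n) p).target).withDensity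
        (fun y => ENNReal.ofReal (μ.density p y))).map (extChartAt (𝓡 n) p).symm := by
  have hs : MeasurableSet (extChartAt (𝓡 n) p).source := (isOpen_extChartAt_source p).measurableSet
  have hT : MeasurableSet (extChartAt (𝓡 n) p).target := (isOpen_extChartAt_target p).measurableSet
  have hm := (aemeasurable_extChartAt_symm (n := n) p)
  have hm' : AEMeasurable (extChartAt (𝓡 n) p).symm
      ((volume.restrict (extChartAt (𝓡 n) p).target).withDensity
        (fun y => ENNReal.ofReal (μ.density p y))) :=
    hm.mono_ac (withDensity_absolutelyContinuous _ _)
  ext A hA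
  rw [Measure.restrict_apply hA, μ.measure_eq p _ (hA.inter hs) inter_subset_right,
    Measure.map_apply_of_aemeasurable hm' hA, withDensity_apply']
  have hpre : NullMeasurableSet ((extChartAt (𝓡 n) p).symm ⁻¹' A)
      (volume.restrict (extChartAt (𝓡 n) p).target) := hm.nullMeasurableSet_preimage hA
  rw [Measure.restrict_restrict₀ hpre]
  congr 2
  ext y
  constructor
  · rintro ⟨x, ⟨hxA, hxs⟩, rfl⟩
    refine ⟨?_, (extChartAt (𝓡 n) p).map_source hxs⟩
    change (extChartAt (𝓡 n) p).symm (extChartAt (𝓡 n) p x) ∈ A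
    rwa [(extChartAt (𝓡 n) p).left_inv hxs]
  · rintro ⟨hyA, hyT⟩
    exact ⟨_, ⟨hyA, (extChartAt (𝓡 n) p).map_target hyT⟩, (extChartAt (𝓡 n) p).right_inv hyT⟩

theorem setIntegral_source_eq (μ : SmoothVolume n M) (p : M) {F : M → ℝ}
    (hF : AEStronglyMeasurable F (μ.measure.restrict (extChartAt (𝓡 n) p).source)) :
    ∫ x in (extChartAt (𝓡 n) p).source, F x ∂μ.measure =
      ∫ y in (extChartAt (𝓡 n) p).target, μ.density p y * F ((extChartAt (𝓡 n) p).symm y) := by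
  rw [restrict_measure_eq_map] at hF ⊢
  rw [integral_map ((aemeasurable_extChartAt_symm p).mono_ac
    (withDensity_absolutelyContinuous _ _)) hF,
    integral_withDensity_eq_integral_toReal_smul₀ (aemeasurable_density μ p)
      (Eventually.of_forall fun _ => ENNReal.ofReal_lt_top)]
  exact integral_congr_ae (toReal_ofReal_density_ae μ p F)

theorem integrableOn_source_iff (μ : SmoothVolume n M) (p : M) {F : M → ℝ}
    (hF : AEStronglyMeasurable F (μ.measure.restrict (extChartAt (𝓡 n) p).source)) :
    IntegrableOn F (extChartAt (𝓡 n) p).source μ.measure ↔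
      IntegrableOn (fun y => μ.density p y * F ((extChartAt (𝓡 n) p).symm y))
        (extChartAt (𝓡 n) p).target := by
  unfold IntegrableOn
  rw [restrict_measure_eq_map] at hF ⊢
  rw [integrable_map_measure hF ((aemeasurable_extChartAt_symm p).mono_ac
    (withDensity_absolutelyContinuous _ _)),
    integrable_withDensity_iff_integrable_smul₀' (aemeasurable_density μ p)
      (Eventually.of_forall fun _ => ENNReal.ofReal_lt_top)]
  exact integrable_congr (toReal_ofReal_density_ae μ p F)

end ChangeOfVariables

/-! ### The divergence theorem localized in a chart -/

/-- The derivative `df(X)` of a function along a vector field. -/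
noncomputable def fieldDeriv {n : ℕ} {M : Type*} [TopologicalSpace M]
    [ChartedSpace (EuclideanSpace ℝ (Fin n)) M] (X : ∀ x : M, TangentSpace (𝓡 n) x) (f : M → ℝ)
    (x : M) : ℝ :=
  mfderiv (𝓡 n) 𝓘(ℝ, ℝ) f x (X x)

section Localized

variable {n : ℕ} {M : Type*} [EMetricSpace M]
    [ChartedSpace (EuclideanSpace ℝ (Fin n)) M] [IsManifold (𝓡 n) ∞ M]

theorem locallyLipschitzOn_comp_extChartAt_symm
    [RiemannianBundle (fun x : M => TangentSpace (𝓡 n) x)]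
    [IsRiemannianManifold (𝓡 n) M]
    [IsContMDiffRiemannianBundle (𝓡 n) ∞ (EuclideanSpace ℝ (Fin n))
      (fun x : M => TangentSpace (𝓡 n) x)] (p : M) {χ : M → ℝ} {L : ℝ≥0}
    (hχ : LipschitzWith L χ) :
    LocallyLipschitzOn (extChartAt (𝓡 n) p).target (fun y => χ ((extChartAt (𝓡 n) p).symm y)) := by
  intro y hy
  obtain ⟨C, t, ht, hC⟩ := locallyLipschitzOn_extChartAt_symm p hy
  exact ⟨L * C, t, ht, hχ.comp_lipschitzOnWith hC⟩

variable [MeasurableSpace M]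

/-- The Leibniz rule `σ⁻¹ ∂ᵢ(φ σ Xⁱ) = φ div X + dφ(X)`, in the chart at `p`. -/
theorem sum_fderiv_mul_density_coordField (μ : SmoothVolume n M) {p : M}
    {y : EuclideanSpace ℝ (Fin n)} (hy : y ∈ (extChartAt (𝓡 n) p).target) {φ : M → ℝ}
    (hφ : ContMDiff (𝓡 n) 𝓘(ℝ, ℝ) 1 φ) {X : ∀ x : M, TangentSpace (𝓡 n) x}
    (hX : ContDiffOn ℝ 1 (coordField p X) (extChartAt (𝓡 n) p).target) :
    ∑ i, fderiv ℝ (fun z => φ ((extChartAt (𝓡 n) p).symm z) *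
        (μ.density p z * coordField p X z i)) y (EuclideanSpace.single i 1) =
      μ.density p y * (φ ((extChartAt (𝓡 n) p).symm y) *
          divergence μ p X ((extChartAt (𝓡 n) p).symm y) +
        fieldDeriv X φ ((extChartAt (𝓡 n) p).symm y)) := by
  have hnhds : (extChartAt (𝓡 n) p).target ∈ 𝓝 y := (isOpen_extChartAt_target p).mem_nhds hy
  have hφd : DifferentiableAt ℝ (fun z => φ ((extChartAt (𝓡 n) p).symm z)) y :=
    ((contDiffOn_comp_extChartAt_symm p hφ).contDiffAt hnhds).differentiableAt (by norm_num)
  have hσd : DifferentiableAt ℝ (μ.density p) y :=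
    ((μ.contDiffOn_density p).contDiffAt hnhds).differentiableAt (by norm_num)
  have hXd : DifferentiableAt ℝ (coordField p X) y :=
    (hX.contDiffAt hnhds).differentiableAt (by norm_num)
  have hXid : ∀ i, DifferentiableAt ℝ (fun z => coordField p X z i) y := fun i => by fun_prop
  have hσX : ∀ i, DifferentiableAt ℝ (fun z => μ.density p z * coordField p X z i) y :=
    fun i => hσd.mul (hXid i)
  have hσ := (μ.density_pos p y hy).ne'
  have hsum : fderiv ℝ (fun z => φ ((extChartAt (𝓡 n) p).symm z)) y (coordField p X y) =
      ∑ i, coordField p X y i *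
        fderiv ℝ (fun z => φ ((extChartAt (𝓡 n) p).symm z)) y (EuclideanSpace.single i 1) := by
    conv_lhs => rw [← (EuclideanSpace.basisFun (Fin n) ℝ).sum_repr (coordField p X y)]
    rw [map_sum]
    refine Finset.sum_congr rfl fun i _ => ?_
    rw [map_smul, smul_eq_mul]
    simp
  have hd := fderiv_comp_extChartAt_symm hy (hφ.mdifferentiable (by norm_num) _)
    (coordField p X y)
  rw [coordFrame_coordField hy] at hd
  rw [fieldDeriv, ← hd, hsum, divergence, (extChartAt (𝓡 n) p).right_inv hy, mul_add,
    mul_left_comm (μ.density p y), mul_inv_cancel_left₀ hσ, Finset.mul_sum, Finset.mul_sum,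
    ← Finset.sum_add_distrib]
  refine Finset.sum_congr rfl fun i _ => ?_
  rw [fderiv_fun_mul hφd (hσX i)]
  simp only [add_apply, smul_apply, smul_eq_mul]
  ring

variable [BorelSpace M] [RiemannianBundle (fun x : M => TangentSpace (𝓡 n) x)]
    [IsRiemannianManifold (𝓡 n) M]
    [IsContMDiffRiemannianBundle (𝓡 n) ∞ (EuclideanSpace ℝ (Fin n))
      (fun x : M => TangentSpace (𝓡 n) x)]

/-- The divergence theorem for `φ X` in a single chart, as an inequality: `φ` localizes, and the
Lipschitz function `χ` is the cutoff. Note that `φ div X + dφ(X) = div (φ X)`. -/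
theorem abs_integral_mul_localized_le (μ : SmoothVolume n M) {p : M} {φ : M → ℝ}
    (hφ : ContMDiff (𝓡 n) 𝓘(ℝ, ℝ) 1 φ) (hφ0 : ∀ x, 0 ≤ φ x) (hφc : HasCompactSupport φ)
    (hφs : tsupport φ ⊆ (extChartAt (𝓡 n) p).source)
    {X : ∀ x : M, TangentSpace (𝓡 n) x}
    (hX : ContDiffOn ℝ 1 (coordField p X) (extChartAt (𝓡 n) p).target)
    {D : M → ℝ} (hD : ∀ x ∈ (extChartAt (𝓡 n) p).source, divergence μ p X x = D x)
    (hXi : Integrable (fun x => ‖X x‖) μ.measure)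
    {χ : M → ℝ} {L : ℝ≥0} (hχ : LipschitzWith L χ) :
    Integrable (fun x => χ x * (φ x * D x + fieldDeriv X φ x)) μ.measure ∧
    |∫ x, χ x * (φ x * D x + fieldDeriv X φ x) ∂μ.measure| ≤
      L * ∫ x, φ x * ‖X x‖ ∂μ.measure := by
  set e := extChartAt (𝓡 n) p with he
  have hopT : IsOpen e.target := isOpen_extChartAt_target p
  have hopS : IsOpen e.source := isOpen_extChartAt_source p
  have hφ' : ContDiffOn ℝ 1 (fun z => φ (e.symm z)) e.target :=
    contDiffOn_comp_extChartAt_symm p hφ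
  have hec : ContinuousOn e e.source := continuousOn_extChartAt p
  set K := e '' tsupport φ with hK
  have hKc : IsCompact K := hφc.isCompact.image_of_continuousOn (hec.mono hφs)
  have hKT : K ⊆ e.target := by
    rintro _ ⟨x, hx, rfl⟩
    exact e.map_source (hφs hx)
  have hφK : ∀ y ∈ e.target, y ∉ K → φ (e.symm y) = 0 := by
    intro y hy hyK
    by_contra h
    exact hyK ⟨e.symm y, subset_tsupport _ h, e.right_inv hy⟩
  -- the coordinate vector field `φ σ X`, extended by zero to a compactly supported `C¹` field
  set G : EuclideanSpace ℝ (Fin n) → EuclideanSpace ℝ (Fin n) :=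
    e.target.indicator (fun y => (φ (e.symm y) * μ.density p y) • coordField p X y) with hG
  have hGT : ∀ y ∈ e.target, G y = (φ (e.symm y) * μ.density p y) • coordField p X y :=
    fun y hy => indicator_of_mem hy _
  have hG0 : ∀ y ∉ K, G y = 0 := by
    intro y hyK
    by_cases hy : y ∈ e.target
    · rw [hGT y hy, hφK y hy hyK, zero_mul, zero_smul]
    · exact indicator_of_notMem hy _
  have hG1 : ContDiff ℝ 1 G := by
    refine contDiff_of_contDiffOn_of_eq_zero hopT ?_ hKc.isClosed hKT hG0
    refine ((hφ'.mul ((μ.contDiffOn_density p).of_le (by exact_mod_cast le_top))).smul hX).congr hGT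
  -- its Euclidean divergence, which is `σ (φ div X + dφ(X))` on the chart
  set dv : EuclideanSpace ℝ (Fin n) → ℝ :=
    fun y => ∑ i, fderiv ℝ (fun z => G z i) y (EuclideanSpace.single i 1) with hdv
  have hdvc : Continuous dv := by
    refine continuous_finsetSum _ fun i _ => ?_
    have : ContDiff ℝ 1 (fun z => G z i) := by fun_prop
    exact (this.continuous_fderiv (by norm_num)).clm_apply continuous_const
  set Q : M → ℝ := fun x => φ x * D x + fieldDeriv X φ x with hQ
  have hdvT : ∀ y ∈ e.target, dv y = μ.density p y * Q (e.symm y) := by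
    intro y hy
    rw [hQ]
    simp only
    rw [← hD _ (e.map_target hy), ← sum_fderiv_mul_density_coordField μ hy hφ hX]
    refine Finset.sum_congr rfl fun i _ => ?_
    have : (fun z => G z i) =ᶠ[𝓝 y] fun z => φ (e.symm z) *
        (μ.density p z * coordField p X z i) := by
      filter_upwards [hopT.mem_nhds hy] with z hz
      rw [hGT z hz]
      simp [mul_assoc]
    rw [this.fderiv_eq]
  have hdv0 : ∀ y ∉ K, dv y = 0 := by
    intro y hy
    refine Finset.sum_eq_zero fun i _ => ?_
    have : (fun z => G z i) =ᶠ[𝓝 y] fun _ => 0 := by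
      filter_upwards [hKc.isClosed.isOpen_compl.mem_nhds hy] with z hz
      simp [hG0 z hz]
    rw [this.fderiv_eq, fderiv_fun_const]; rfl
  have hQ0 : ∀ x ∉ e.source, χ x * Q x = 0 := by
    intro x hx
    have h1 : x ∉ tsupport φ := fun h => hx (hφs h)
    have h2 : φ =ᶠ[𝓝 x] fun _ => 0 := notMem_tsupport_iff_eventuallyEq.1 h1
    have h3 : fieldDeriv X φ x = 0 := by
      rw [fieldDeriv, h2.mfderiv_eq, mfderiv_const]; rfl
    rw [hQ]
    simp only
    rw [h3, image_eq_zero_of_notMem_tsupport h1, zero_mul, add_zero, mul_zero]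
  have hfc : ContinuousOn (fun x => (μ.density p (e x))⁻¹ * (χ x * dv (e x))) e.source := by
    refine ContinuousOn.mul (ContinuousOn.inv₀ ?_ ?_)
      (hχ.continuous.continuousOn.mul (hdvc.comp_continuousOn hec))
    · exact (μ.contDiffOn_density p).continuousOn.comp hec e.mapsTo
    · exact fun x hx => (μ.density_pos p _ (e.map_source hx)).ne'
  have hQm : AEStronglyMeasurable (fun x => χ x * Q x) (μ.measure.restrict e.source) := by
    refine ContinuousOn.aestronglyMeasurable ?_ hopS.measurableSet
    refine hfc.congr fun x hx => ?_
    simp only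
    rw [hdvT _ (e.map_source hx), e.left_inv hx]
    field_simp [(μ.density_pos p _ (e.map_source hx)).ne']
  have hNm : Integrable (fun x => L * (φ x * ‖X x‖)) μ.measure := by
    obtain ⟨C, hC⟩ := hφ.continuous.bounded_above_of_compact_support hφc
    exact (hXi.bdd_mul (c := C) hφ.continuous.aestronglyMeasurable
      (Eventually.of_forall hC)).const_mul _
  have hN0 : ∀ x ∉ e.source, L * (φ x * ‖X x‖) = 0 := by
    intro x hx
    rw [image_eq_zero_of_notMem_tsupport (fun h => hx (hφs h)), zero_mul, mul_zero]
  have hNT : IntegrableOn (fun y => μ.density p y * (L * (φ (e.symm y) * ‖X (e.symm y)‖)))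
      e.target :=
    (integrableOn_source_iff μ p hNm.aestronglyMeasurable.restrict).1 hNm.integrableOn
  have hlhs : ∫ x, χ x * Q x ∂μ.measure = ∫ y, χ (e.symm y) * dv y := by
    rw [← setIntegral_eq_integral_of_forall_compl_eq_zero hQ0, setIntegral_source_eq μ p hQm,
      ← setIntegral_eq_integral_of_forall_compl_eq_zero (s := e.target) (μ := volume)
        (f := fun y => χ (e.symm y) * dv y)
        (fun y hy => by rw [hdv0 y (fun h => hy (hKT h)), mul_zero])]
    refine setIntegral_congr_fun hopT.measurableSet fun y hy => ?_
    rw [hdvT y hy]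
    ring
  have hrhs : L * ∫ x, φ x * ‖X x‖ ∂μ.measure = ∫ y, e.target.indicator
      (fun y => μ.density p y * (L * (φ (e.symm y) * ‖X (e.symm y)‖))) y := by
    rw [integral_indicator hopT.measurableSet, ← integral_const_mul,
      ← setIntegral_eq_integral_of_forall_compl_eq_zero hN0,
      setIntegral_source_eq μ p hNm.aestronglyMeasurable.restrict]
  refine ⟨?_, ?_⟩
  · have h1 : IntegrableOn (fun y => χ (e.symm y) * dv y) K :=
      ((hχ.continuous.comp_continuousOn ((continuousOn_extChartAt_symm p).mono hKT)).mul
        hdvc.continuousOn).integrableOn_compact hKc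
    have h2 : IntegrableOn (fun y => χ (e.symm y) * dv y) e.target :=
      h1.of_forall_sdiff_eq_zero hopT.measurableSet
        (fun y hy => by rw [hdv0 y hy.2, mul_zero])
    have h3 : IntegrableOn (fun x => χ x * Q x) e.source μ.measure := by
      refine (integrableOn_source_iff μ p hQm).2 (h2.congr_fun (fun y hy => ?_) hopT.measurableSet)
      simp only
      rw [hdvT y hy]
      ring
    exact h3.integrable_of_forall_notMem_eq_zero hQ0
  rw [hlhs, hrhs]
  refine abs_integral_mul_sum_fderiv_le hopT hKc hKT
    (locallyLipschitzOn_comp_extChartAt_symm p hχ) hG1 hG0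
    (hNT.integrable_indicator hopT.measurableSet) ?_ ?_
  · refine fun y => indicator_nonneg (fun y hy => ?_) y
    have := (μ.density_pos p y hy).le
    have := hφ0 (e.symm y)
    positivity
  · intro y hy hd
    have h1 := abs_fderiv_comp_extChartAt_symm_le hy hχ hd (coordField p X y)
    rw [coordFrame_coordField hy] at h1
    have h2 := (μ.density_pos p y hy).le
    have h3 := hφ0 (e.symm y)
    rw [indicator_of_mem hy, hGT y hy, map_smul, smul_eq_mul, abs_mul,
      abs_of_nonneg (mul_nonneg h3 h2)]
    calc _ ≤ φ (e.symm y) * μ.density p y * (L * ‖X (e.symm y)‖) := by gcongr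
      _ = _ := by ring

end Localized

/-! ### The divergence theorem on a complete manifold -/

section Gaffney

theorem fieldDeriv_eq_zero_of_eventuallyEq_const {n : ℕ} {M : Type*} [TopologicalSpace M]
    [ChartedSpace (EuclideanSpace ℝ (Fin n)) M] (X : ∀ x : M, TangentSpace (𝓡 n) x)
    {f : M → ℝ} {x : M} {c : ℝ} (h : f =ᶠ[𝓝 x] fun _ => c) : fieldDeriv X f x = 0 := by
  rw [fieldDeriv, h.mfderiv_eq, mfderiv_const]; rfl

theorem sum_fieldDeriv {n : ℕ} {M : Type*} [TopologicalSpace M]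
    [ChartedSpace (EuclideanSpace ℝ (Fin n)) M] (X : ∀ x : M, TangentSpace (𝓡 n) x)
    {ι : Type*} (s : Finset ι) {f : ι → M → ℝ} {x : M}
    (hf : ∀ i ∈ s, MDifferentiableAt (𝓡 n) 𝓘(ℝ, ℝ) (f i) x) :
    ∑ i ∈ s, fieldDeriv X (f i) x = fieldDeriv X (fun z => ∑ i ∈ s, f i z) x := by
  classical
  induction s using Finset.induction_on with
  | empty =>
    simp only [Finset.sum_empty]
    exact (fieldDeriv_eq_zero_of_eventuallyEq_const X (c := 0) EventuallyEq.rfl).symm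
  | insert i s hi ih =>
    have hs : MDifferentiableAt (𝓡 n) 𝓘(ℝ, ℝ) (fun z => ∑ j ∈ s, f j z) x := by
      have : ∀ t ⊆ s, MDifferentiableAt (𝓡 n) 𝓘(ℝ, ℝ) (fun z => ∑ j ∈ t, f j z) x := by
        intro t
        induction t using Finset.induction_on with
        | empty => exact fun _ => by simpa using mdifferentiableAt_const
        | insert k t hk iht =>
          intro ht
          simp only [Finset.sum_insert hk]
          exact (hf k (Finset.mem_insert_of_mem (ht (Finset.mem_insert_self k t)))).add
            (iht ((Finset.subset_insert k t).trans ht))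
      exact this s subset_rfl
    have h := mfderiv_add (hf i (Finset.mem_insert_self i s)) hs
    simp only [Finset.sum_insert hi]
    rw [ih fun j hj => hf j (Finset.mem_insert_of_mem hj)]
    exact (DFunLike.congr_fun h (X x)).symm

/-- If closed balls are compact, then there are compactly supported cutoffs with values in
`[0, 1]`, with Lipschitz constants tending to zero, which tend to `1` pointwise. The space may have
infinitely many components at infinite distance from each other. -/
theorem exists_cutoff {M : Type*} [EMetricSpace M] [SecondCountableTopology M]
    (hcomplete : ∀ (x : M) (r : ℝ≥0), IsCompact (Metric.closedEBall x (r : ℝ≥0∞))) :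
    ∃ χ : ℕ → M → ℝ, (∀ N : ℕ, LipschitzWith (N + 1 : ℝ≥0)⁻¹ (χ N)) ∧
      (∀ N, HasCompactSupport (χ N)) ∧ (∀ N x, 0 ≤ χ N x ∧ χ N x ≤ 1) ∧
      ∀ x, ∀ᶠ N in atTop, χ N x = 1 := by
  rcases isEmpty_or_nonempty M with hM | hM
  · exact ⟨fun _ _ => 0, fun N => LipschitzWith.const' 0, fun N => HasCompactSupport.zero,
      fun N x => ⟨le_rfl, zero_le_one⟩, fun x => (hM.false x).elim⟩
  -- `χ N` is `1` on the union of the `N`-balls around the first `N + 1` points of a dense sequence,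
  -- and decreases linearly to zero at distance `N + 1` from it
  set u := TopologicalSpace.denseSeq M with hu
  set E : ℕ → Set M := fun N => ⋃ j ∈ Finset.range (N + 1), Metric.closedEBall (u j) (N : ℝ≥0)
    with hE
  have hpos : ∀ N : ℕ, (0 : ℝ) < N + 1 := fun N => by positivity
  refine ⟨fun N x => (thickenedIndicator (hpos N) (E N) x : ℝ), fun N => ?_, fun N => ?_,
    fun N x => ⟨NNReal.coe_nonneg _, ?_⟩, fun x => ?_⟩
  · have h := lipschitzWith_thickenedIndicator (hpos N) (E N)
    have h2 : ((N : ℝ) + 1).toNNReal = (N + 1 : ℝ≥0) := by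
      ext; rw [Real.coe_toNNReal _ (hpos N).le]; push_cast; rfl
    rw [h2] at h
    intro x y
    exact h x y
  · have hc : IsCompact (⋃ j ∈ Finset.range (N + 1),
        Metric.closedEBall (u j) ((2 * N + 1 : ℝ≥0) : ℝ≥0∞)) :=
      (Finset.range (N + 1)).isCompact_biUnion fun j _ => hcomplete _ _
    refine HasCompactSupport.of_support_subset_isCompact hc fun x hx => ?_
    have hx1 : x ∈ Metric.thickening ((N : ℝ) + 1) (E N) := by
      by_contra h
      exact hx (by simp [thickenedIndicator_zero (hpos N) (E N) h])
    obtain ⟨z, hz, hxz⟩ := (Metric.mem_thickening_iff_exists_edist_lt _ _).1 hx1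
    obtain ⟨j, hj, hzj⟩ := mem_iUnion₂.1 hz
    refine mem_iUnion₂.2 ⟨j, hj, ?_⟩
    rw [Metric.mem_closedEBall] at hzj ⊢
    refine (edist_triangle _ z _).trans ((add_le_add hxz.le hzj).trans (le_of_eq ?_))
    rw [ENNReal.ofReal_add (by positivity) zero_le_one]
    simp
    ring
  · exact_mod_cast thickenedIndicator_le_one (hpos N) (E N) x
  · obtain ⟨j, hj⟩ := (TopologicalSpace.denseRange_denseSeq M).exists_mem_open
      (Metric.isOpen_eball (x := x) (ε := 1)) ⟨x, Metric.mem_eball_self one_pos⟩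
    filter_upwards [eventually_ge_atTop (max j 1)] with N hN
    have hxE : x ∈ E N := by
      refine mem_iUnion₂.2 ⟨j, Finset.mem_range.2 (by omega), ?_⟩
      rw [Metric.mem_closedEBall, edist_comm]
      refine (le_of_lt hj).trans ?_
      have : 1 ≤ N := by omega
      exact_mod_cast this
    rw [thickenedIndicator_one (hpos N) (E N) hxE]
    rfl

variable {n : ℕ} {M : Type*} [EMetricSpace M]
    [ChartedSpace (EuclideanSpace ℝ (Fin n)) M] [IsManifold (𝓡 n) ∞ M]
    [RiemannianBundle (fun x : M => TangentSpace (𝓡 n) x)]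
    [IsContMDiffRiemannianBundle (𝓡 n) ∞ (EuclideanSpace ℝ (Fin n))
      (fun x : M => TangentSpace (𝓡 n) x)]
    [IsRiemannianManifold (𝓡 n) M] [SecondCountableTopology M]
    [MeasurableSpace M] [BorelSpace M]

/-- The divergence theorem against a compactly supported Lipschitz cutoff, obtained by summing the
estimates in charts over a finite partition of unity. -/
theorem abs_integral_mul_divergence_le (μ : SmoothVolume n M)
    {X : ∀ x : M, TangentSpace (𝓡 n) x}
    (hX : ∀ p, ContDiffOn ℝ 1 (coordField p X) (extChartAt (𝓡 n) p).target)
    {D : M → ℝ} (hD : ∀ p, ∀ x ∈ (extChartAt (𝓡 n) p).source, divergence μ p X x = D x)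
    (hXi : Integrable (fun x => ‖X x‖) μ.measure)
    {χ : M → ℝ} {L : ℝ≥0} (hχ : LipschitzWith L χ) (hχc : HasCompactSupport χ) :
    |∫ x, χ x * D x ∂μ.measure| ≤ L * ∫ x, ‖X x‖ ∂μ.measure := by
  have : LocallyCompactSpace M := ChartedSpace.locallyCompactSpace (EuclideanSpace ℝ (Fin n)) M
  have hnb : ∀ p : M, ∃ K, IsCompact K ∧ K ∈ 𝓝 p ∧ K ⊆ (extChartAt (𝓡 n) p).source := by
    intro p
    obtain ⟨K, hK1, hK2, hK3⟩ := exists_compact_subset (isOpen_extChartAt_source (I := 𝓡 n) p)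
      (mem_extChartAt_source p)
    exact ⟨K, hK1, mem_interior_iff_mem_nhds.1 hK2, hK3⟩
  choose K hKc hKn hKs using hnb
  obtain ⟨F, hF⟩ := hχc.isCompact.elim_finite_subcover (fun p => interior (K p))
    (fun p => isOpen_interior)
    (fun x _ => mem_iUnion.2 ⟨x, mem_interior_iff_mem_nhds.2 (hKn x)⟩)
  obtain ⟨φ, hφ⟩ := SmoothPartitionOfUnity.exists_isSubordinate (𝓡 n) (ι := F)
    (isClosed_tsupport χ) (fun p => interior (K p)) (fun p => isOpen_interior)
    (fun x hx => by simpa using hF hx)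
  have hφs : ∀ i : F, tsupport (φ i) ⊆ K i := fun i => (hφ i).trans interior_subset
  have hφc : ∀ i : F, HasCompactSupport (φ i) := fun i =>
    HasCompactSupport.of_support_subset_isCompact (hKc i) ((subset_tsupport _).trans (hφs i))
  have hφ1 : ∀ i : F, ContMDiff (𝓡 n) 𝓘(ℝ, ℝ) 1 (φ i) := fun i =>
    (φ i).contMDiff.of_le (by exact_mod_cast le_top)
  have key := fun i : F => abs_integral_mul_localized_le μ (hφ1 i) (fun x => φ.nonneg i x) (hφc i)
    ((hφs i).trans (hKs i)) (hX i) (hD i) hXi hχ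
  have hsum1 : ∀ x ∈ tsupport χ, ∑ i, φ i x = 1 := fun x hx => by
    rw [← finsum_eq_sum_of_fintype]; exact φ.sum_eq_one hx
  have hpt : ∀ x, ∑ i, χ x * (φ i x * D x + fieldDeriv X (φ i) x) = χ x * D x := by
    intro x
    by_cases hx : χ x = 0
    · simp [hx]
    have hxs : x ∈ tsupport χ := subset_tsupport _ hx
    -- `∑ φᵢ = 1` near `x`
    have hder : ∑ i, fieldDeriv X (φ i) x = 0 := by
      rw [sum_fieldDeriv X _ (fun i _ => (hφ1 i).mdifferentiable (by norm_num) x)]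
      refine fieldDeriv_eq_zero_of_eventuallyEq_const X (c := 1) ?_
      filter_upwards [(hχ.continuous.continuousAt (x := x)).eventually_ne hx] with z hz
      exact hsum1 z (subset_tsupport _ hz)
    rw [← Finset.mul_sum, Finset.sum_add_distrib, ← Finset.sum_mul, hsum1 x hxs, hder, one_mul,
      add_zero]
  have hint : ∀ i : F, Integrable (fun x => φ i x * ‖X x‖) μ.measure := fun i =>
    hXi.bdd_mul (c := 1) (hφ1 i).continuous.aestronglyMeasurable
      (Eventually.of_forall fun x => by
        rw [Real.norm_of_nonneg (φ.nonneg i x)]; exact φ.le_one i x)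
  calc |∫ x, χ x * D x ∂μ.measure|
      = |∑ i, ∫ x, χ x * (φ i x * D x + fieldDeriv X (φ i) x) ∂μ.measure| := by
        rw [← integral_finsetSum _ (fun i _ => (key i).1)]
        simp only [hpt]
    _ ≤ ∑ i, |∫ x, χ x * (φ i x * D x + fieldDeriv X (φ i) x) ∂μ.measure| :=
        Finset.abs_sum_le_sum_abs _ _
    _ ≤ ∑ i, L * ∫ x, φ i x * ‖X x‖ ∂μ.measure := Finset.sum_le_sum fun i _ => (key i).2
    _ = L * ∫ x, (∑ i, φ i x) * ‖X x‖ ∂μ.measure := by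
        simp only [Finset.sum_mul]
        rw [← Finset.mul_sum, ← integral_finsetSum _ (fun i _ => hint i)]
    _ ≤ L * ∫ x, ‖X x‖ ∂μ.measure := by
        refine mul_le_mul_of_nonneg_left (integral_mono_of_nonneg ?_ hXi ?_) L.2
        · exact Eventually.of_forall fun x =>
            mul_nonneg (Finset.sum_nonneg fun i _ => φ.nonneg i x) (norm_nonneg _)
        · refine Eventually.of_forall fun x => mul_le_of_le_one_left (norm_nonneg _) ?_
          rw [← finsum_eq_sum_of_fintype]; exact φ.sum_le_one x

/-- **Gaffney's divergence theorem**: on a complete Riemannian manifold, the divergence of an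
integrable `C¹` vector field has integral zero as soon as it is integrable. -/
theorem integral_divergence_eq_zero
    (hcomplete : ∀ (x : M) (r : ℝ≥0), IsCompact (Metric.closedEBall x (r : ℝ≥0∞)))
    (μ : SmoothVolume n M) {X : ∀ x : M, TangentSpace (𝓡 n) x}
    (hX : ∀ p, ContDiffOn ℝ 1 (coordField p X) (extChartAt (𝓡 n) p).target)
    {D : M → ℝ} (hD : ∀ p, ∀ x ∈ (extChartAt (𝓡 n) p).source, divergence μ p X x = D x)
    (hXi : Integrable (fun x => ‖X x‖) μ.measure) (hDi : Integrable D μ.measure) :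
    ∫ x, D x ∂μ.measure = 0 := by
  obtain ⟨χ, hL, hc, h01, h1⟩ := exists_cutoff hcomplete
  have hlim : Tendsto (fun N => ∫ x, χ N x * D x ∂μ.measure) atTop
      (𝓝 (∫ x, D x ∂μ.measure)) := by
    refine tendsto_integral_of_dominated_convergence (fun x => ‖D x‖)
      (fun N => (hL N).continuous.aestronglyMeasurable.mul hDi.aestronglyMeasurable) hDi.norm
      (fun N => Eventually.of_forall fun x => ?_) (Eventually.of_forall fun x => ?_)
    · rw [norm_mul, Real.norm_of_nonneg (h01 N x).1]
      exact mul_le_of_le_one_left (norm_nonneg _) (h01 N x).2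
    · refine tendsto_const_nhds.congr' ?_
      filter_upwards [h1 x] with N hN
      rw [hN, one_mul]
  have hzero : Tendsto (fun N => ∫ x, χ N x * D x ∂μ.measure) atTop (𝓝 0) := by
    have hb : Tendsto (fun N : ℕ => (1 / ((N : ℝ) + 1)) * ∫ x, ‖X x‖ ∂μ.measure) atTop (𝓝 0) := by
      simpa using tendsto_one_div_add_atTop_nhds_zero_nat.mul_const (∫ x, ‖X x‖ ∂μ.measure)
    refine squeeze_zero_norm (fun N => ?_) hb
    have := abs_integral_mul_divergence_le μ hX hD hXi (hL N) (hc N)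
    rw [Real.norm_eq_abs]
    simpa using this
  exact tendsto_nhds_unique hlim hzero

end Gaffney

/-! ### Transport and energy: divergence identities for `ρ ∇θ` -/

section Truncation

theorem hasDerivAt_div_one_add_mul_sq {ε : ℝ} (hε : 0 ≤ ε) (s : ℝ) :
    HasDerivAt (fun s => s / (1 + ε * s ^ 2)) ((1 - ε * s ^ 2) / (1 + ε * s ^ 2) ^ 2) s := by
  have hpos : 1 + ε * s ^ 2 ≠ 0 := by positivity
  have h1 : HasDerivAt (fun s : ℝ => 1 + ε * s ^ 2) (ε * (2 * s)) s := by
    simpa using ((hasDerivAt_pow 2 s).const_mul ε).const_add 1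
  refine ((hasDerivAt_id s).div h1 hpos).congr_deriv ?_
  simp only [id]
  congr 1
  ring

theorem abs_div_one_add_mul_sq_le {ε : ℝ} (hε : 0 ≤ ε) (s : ℝ) :
    |s / (1 + ε * s ^ 2)| ≤ |s| := by
  have hpos : 0 ≤ ε * s ^ 2 := by positivity
  rw [abs_div, abs_of_pos (by linarith : 0 < 1 + ε * s ^ 2)]
  exact div_le_self (abs_nonneg s) (by linarith)

theorem abs_div_one_add_mul_sq_le_inv {ε : ℝ} (hε : 0 < ε) (hε1 : ε ≤ 1) (s : ℝ) :
    |s / (1 + ε * s ^ 2)| ≤ ε⁻¹ := by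
  have hpos : 0 < 1 + ε * s ^ 2 := by positivity
  rw [abs_div, abs_of_pos hpos, div_le_iff₀ hpos, mul_add, mul_one, inv_mul_cancel_left₀ hε.ne']
  have h1 : 1 ≤ ε⁻¹ := (one_le_inv₀ hε).2 hε1
  have h2 : |s| ≤ 1 + s ^ 2 := by nlinarith [sq_abs s, sq_nonneg (|s| - 1), abs_nonneg s]
  linarith

theorem abs_deriv_div_one_add_mul_sq_le {ε : ℝ} (hε : 0 ≤ ε) (s : ℝ) :
    |(1 - ε * s ^ 2) / (1 + ε * s ^ 2) ^ 2| ≤ 1 := by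
  have hpos : 0 ≤ ε * s ^ 2 := by positivity
  rw [abs_div, abs_of_pos (show 0 < (1 + ε * s ^ 2) ^ 2 by positivity),
    div_le_one (by positivity), abs_le]
  constructor <;> nlinarith

end Truncation

section Flux

section

variable {n : ℕ} {M : Type*} [TopologicalSpace M] [ChartedSpace (EuclideanSpace ℝ (Fin n)) M]
    [RiemannianBundle (fun x : M => TangentSpace (𝓡 n) x)]

theorem fieldDeriv_smul_riemGrad_comp {T : ℝ → ℝ} {T' : ℝ} {ρ θ : M → ℝ} {x : M}
    (hT : HasDerivAt T T' (θ x)) (hθ : MDifferentiableAt (𝓡 n) 𝓘(ℝ, ℝ) θ x) :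
    fieldDeriv (fun z => ρ z • riemGrad (n := n) θ z) (fun z => T (θ z)) x =
      T' * (‖riemGrad (n := n) θ x‖ ^ 2 * ρ x) := by
  have h1 := hT.hasFDerivAt.hasMFDerivAt.comp x hθ.hasMFDerivAt
  have h2 : fieldDeriv (fun z => ρ z • riemGrad (n := n) θ z) (fun z => T (θ z)) x =
      fieldDeriv (fun z => ρ z • riemGrad (n := n) θ z) θ x * T' := by
    unfold fieldDeriv
    exact DFunLike.congr_fun h1.mfderiv (ρ x • riemGrad (n := n) θ x)
  have h3 : fieldDeriv (fun z => ρ z • riemGrad (n := n) θ z) θ x =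
      ρ x * ‖riemGrad (n := n) θ x‖ ^ 2 := by
    unfold fieldDeriv
    rw [← inner_riemGrad, inner_smul_right, real_inner_self_eq_norm_sq]
  rw [h2, h3]
  ring

/-- A momentum density of finite mass and energy is integrable, by the Cauchy–Schwarz
inequality. -/
theorem integrable_norm_smul_riemGrad [MeasurableSpace M] [BorelSpace M]
    (μ : SmoothVolume n M) {ρ θ : M → ℝ}
    (hρc : Continuous ρ) (hρ0 : ∀ x, 0 < ρ x) (hρi : Integrable ρ μ.measure)
    (hEi : Integrable (fun x => ‖riemGrad (n := n) θ x‖ ^ 2 * ρ x) μ.measure) :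
    Integrable (fun x => ‖ρ x • riemGrad (n := n) θ x‖) μ.measure := by
  have heq : ∀ x, ‖ρ x • riemGrad (n := n) θ x‖ =
      √(ρ x * (‖riemGrad (n := n) θ x‖ ^ 2 * ρ x)) := by
    intro x
    rw [show ρ x * (‖riemGrad (n := n) θ x‖ ^ 2 * ρ x) =
      (ρ x * ‖riemGrad (n := n) θ x‖) ^ 2 by ring,
      Real.sqrt_sq (mul_nonneg (hρ0 x).le (norm_nonneg _)), norm_smul,
      Real.norm_of_nonneg (hρ0 x).le]
  refine (hρi.add hEi).mono' ?_ (Eventually.of_forall fun x => ?_)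
  · simp only [heq]
    exact Real.continuous_sqrt.comp_aestronglyMeasurable
      (hρc.aestronglyMeasurable.mul hEi.aestronglyMeasurable)
  · rw [norm_norm, norm_smul, Real.norm_of_nonneg (hρ0 x).le, Pi.add_apply]
    have := hρ0 x
    nlinarith [mul_nonneg this.le (sq_nonneg (‖riemGrad (n := n) θ x‖ - 1)),
      mul_nonneg this.le (sq_nonneg (‖riemGrad (n := n) θ x‖))]

end

variable {n : ℕ} {M : Type*} [EMetricSpace M]
    [ChartedSpace (EuclideanSpace ℝ (Fin n)) M] [IsManifold (𝓡 n) ∞ M]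

theorem contDiffOn_coordField_smul {p : M} {φ : M → ℝ}
    (hφ : ContMDiff (𝓡 n) 𝓘(ℝ, ℝ) 1 φ) {X : ∀ x : M, TangentSpace (𝓡 n) x}
    (hX : ContDiffOn ℝ 1 (coordField p X) (extChartAt (𝓡 n) p).target) :
    ContDiffOn ℝ 1 (coordField p (fun z => φ z • X z)) (extChartAt (𝓡 n) p).target :=
  ((contDiffOn_comp_extChartAt_symm p hφ).smul hX).congr fun y _ => coordField_smul p φ X y

variable [MeasurableSpace M]

theorem divergence_smul (μ : SmoothVolume n M) {p : M} {φ : M → ℝ}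
    (hφ : ContMDiff (𝓡 n) 𝓘(ℝ, ℝ) 1 φ) {X : ∀ x : M, TangentSpace (𝓡 n) x}
    (hX : ContDiffOn ℝ 1 (coordField p X) (extChartAt (𝓡 n) p).target) {x : M}
    (hx : x ∈ (extChartAt (𝓡 n) p).source) :
    divergence μ p (fun z => φ z • X z) x = φ x * divergence μ p X x + fieldDeriv X φ x := by
  have hy := (extChartAt (𝓡 n) p).map_source hx
  have h := sum_fderiv_mul_density_coordField μ hy hφ hX
  rw [(extChartAt (𝓡 n) p).left_inv hx] at h
  rw [divergence, inv_mul_eq_iff_eq_mul₀ (μ.density_pos p _ hy).ne', ← h]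
  refine Finset.sum_congr rfl fun i _ => ?_
  congr 2
  ext y
  rw [coordField_smul, PiLp.smul_apply, smul_eq_mul]
  ring

variable [BorelSpace M]
    [RiemannianBundle (fun x : M => TangentSpace (𝓡 n) x)]

variable [IsContMDiffRiemannianBundle (𝓡 n) ∞ (EuclideanSpace ℝ (Fin n))
      (fun x : M => TangentSpace (𝓡 n) x)]
    [IsRiemannianManifold (𝓡 n) M] [SecondCountableTopology M]

/-- Conservation of mass by transport: `∫ div (ρ ∇θ) = 0`. -/
theorem integral_divergence_smul_riemGrad
    (hcomplete : ∀ (x : M) (r : ℝ≥0), IsCompact (Metric.closedEBall x (r : ℝ≥0∞)))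
    (μ : SmoothVolume n M) {ρ θ : M → ℝ} (hρ : ContMDiff (𝓡 n) 𝓘(ℝ, ℝ) 1 ρ)
    (hθ : ContMDiff (𝓡 n) 𝓘(ℝ, ℝ) 2 θ) (hρ0 : ∀ x, 0 < ρ x) (hρi : Integrable ρ μ.measure)
    (hEi : Integrable (fun x => ‖riemGrad (n := n) θ x‖ ^ 2 * ρ x) μ.measure)
    {D : M → ℝ} (hD : ∀ p, ∀ x ∈ (extChartAt (𝓡 n) p).source,
      divergence μ p (fun z => ρ z • riemGrad (n := n) θ z) x = D x)
    (hDi : Integrable D μ.measure) : ∫ x, D x ∂μ.measure = 0 :=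
  integral_divergence_eq_zero hcomplete μ
    (fun p => contDiffOn_coordField_smul hρ (contDiffOn_coordField_riemGrad p hθ)) hD
    (integrable_norm_smul_riemGrad μ hρ.continuous hρ0 hρi hEi) hDi

/-- Green's formula `∫ θ div (ρ ∇θ) = -∫ |∇θ|² ρ`. The field `θ ρ ∇θ` need not be integrable, so
the divergence theorem is applied to the bounded truncations `θ / (1 + ε θ²)` in place of the first
factor `θ`, and then `ε → 0`. -/
theorem integral_mul_divergence_smul_riemGrad
    (hcomplete : ∀ (x : M) (r : ℝ≥0), IsCompact (Metric.closedEBall x (r : ℝ≥0∞)))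
    (μ : SmoothVolume n M) {ρ θ : M → ℝ} (hρ : ContMDiff (𝓡 n) 𝓘(ℝ, ℝ) 1 ρ)
    (hθ : ContMDiff (𝓡 n) 𝓘(ℝ, ℝ) 2 θ) (hρ0 : ∀ x, 0 < ρ x) (hρi : Integrable ρ μ.measure)
    (hEi : Integrable (fun x => ‖riemGrad (n := n) θ x‖ ^ 2 * ρ x) μ.measure)
    {D : M → ℝ} (hD : ∀ p, ∀ x ∈ (extChartAt (𝓡 n) p).source,
      divergence μ p (fun z => ρ z • riemGrad (n := n) θ z) x = D x)
    (hDi : Integrable D μ.measure) (hθD : Integrable (fun x => θ x * D x) μ.measure) :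
    ∫ x, θ x * D x ∂μ.measure = -∫ x, ‖riemGrad (n := n) θ x‖ ^ 2 * ρ x ∂μ.measure := by
  have hθ1 : ContMDiff (𝓡 n) 𝓘(ℝ, ℝ) 1 θ := hθ.of_le (by norm_num)
  have hX0 : ∀ p, ContDiffOn ℝ 1 (coordField p (fun z => ρ z • riemGrad (n := n) θ z))
      (extChartAt (𝓡 n) p).target :=
    fun p => contDiffOn_coordField_smul hρ (contDiffOn_coordField_riemGrad p hθ)
  have hX0i := integrable_norm_smul_riemGrad μ hρ.continuous hρ0 hρi hEi
  set T : ℝ → ℝ → ℝ := fun ε s => s / (1 + ε * s ^ 2) with hT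
  set T' : ℝ → ℝ → ℝ := fun ε s => (1 - ε * s ^ 2) / (1 + ε * s ^ 2) ^ 2 with hT'
  set W : M → ℝ := fun x => ‖riemGrad (n := n) θ x‖ ^ 2 * ρ x with hW
  have hTs : ∀ ε, 0 ≤ ε → ContDiff ℝ 1 (T ε) := by
    intro ε hε
    refine contDiff_id.div (by fun_prop) fun s => ?_
    positivity
  have hT'c : ∀ ε, 0 ≤ ε → Continuous (T' ε) := by
    intro ε hε
    refine Continuous.div (by fun_prop) (by fun_prop) fun s => ?_
    positivity
  -- the identity for the truncations
  have htr : ∀ ε, 0 < ε → ε ≤ 1 →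
      ∫ x, T ε (θ x) * D x ∂μ.measure = -∫ x, T' ε (θ x) * W x ∂μ.measure := by
    intro ε hε hε1
    have hφ : ContMDiff (𝓡 n) 𝓘(ℝ, ℝ) 1 (fun x => T ε (θ x)) :=
      (hTs ε hε.le).contMDiff.comp hθ1
    have hi1 : Integrable (fun x => T ε (θ x) * D x) μ.measure :=
      hDi.bdd_mul (c := ε⁻¹) hφ.continuous.aestronglyMeasurable
        (Eventually.of_forall fun x => abs_div_one_add_mul_sq_le_inv hε hε1 (θ x))
    have hi2 : Integrable (fun x => T' ε (θ x) * W x) μ.measure :=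
      hEi.bdd_mul (c := 1) ((hT'c ε hε.le).comp hθ.continuous).aestronglyMeasurable
        (Eventually.of_forall fun x => abs_deriv_div_one_add_mul_sq_le hε.le (θ x))
    have h0 := integral_divergence_eq_zero hcomplete μ
      (X := fun z => T ε (θ z) • (ρ z • riemGrad (n := n) θ z))
      (D := fun x => T ε (θ x) * D x + T' ε (θ x) * W x)
      (fun p => contDiffOn_coordField_smul hφ (hX0 p))
      (fun p x hx => by
        rw [divergence_smul μ hφ (hX0 p) hx, hD p x hx, fieldDeriv_smul_riemGrad_comp
          (hasDerivAt_div_one_add_mul_sq hε.le (θ x)) (hθ.mdifferentiable (by norm_num) x)])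
      (by
        simp only [norm_smul (T ε _)]
        exact hX0i.bdd_mul (c := ε⁻¹) hφ.continuous.norm.aestronglyMeasurable
          (Eventually.of_forall fun x => by
            rw [norm_norm]; exact abs_div_one_add_mul_sq_le_inv hε hε1 (θ x)))
      (hi1.add hi2)
    rw [integral_add hi1 hi2] at h0
    linarith
  have hlimε : Tendsto (fun N : ℕ => 1 / ((N : ℝ) + 1)) atTop (𝓝 0) :=
    tendsto_one_div_add_atTop_nhds_zero_nat
  have hpos : ∀ N : ℕ, 0 < 1 / ((N : ℝ) + 1) := fun N => by positivity
  have hle : ∀ N : ℕ, 1 / ((N : ℝ) + 1) ≤ 1 := fun N => by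
    rw [div_le_one (by positivity)]; linarith [(Nat.cast_nonneg N : (0 : ℝ) ≤ N)]
  have hl1 : Tendsto (fun N : ℕ => ∫ x, T (1 / ((N : ℝ) + 1)) (θ x) * D x ∂μ.measure) atTop
      (𝓝 (∫ x, θ x * D x ∂μ.measure)) := by
    refine tendsto_integral_of_dominated_convergence (fun x => ‖θ x * D x‖)
      (fun N => ((hTs _ (hpos N).le).continuous.comp hθ.continuous).aestronglyMeasurable.mul
        hDi.aestronglyMeasurable) hθD.norm
      (fun N => Eventually.of_forall fun x => ?_) (Eventually.of_forall fun x => ?_)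
    · rw [norm_mul, norm_mul]
      exact mul_le_mul_of_nonneg_right (abs_div_one_add_mul_sq_le (hpos N).le (θ x))
        (norm_nonneg _)
    · have hc : ContinuousAt (fun ε => T ε (θ x)) 0 := by
        refine ContinuousAt.div (by fun_prop) (by fun_prop) ?_
        simp
      have := (hc.tendsto.comp hlimε).mul_const (D x)
      simpa [hT] using this
  have hl2 : Tendsto (fun N : ℕ => ∫ x, T' (1 / ((N : ℝ) + 1)) (θ x) * W x ∂μ.measure) atTop
      (𝓝 (∫ x, W x ∂μ.measure)) := by
    refine tendsto_integral_of_dominated_convergence (fun x => ‖W x‖)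
      (fun N => ((hT'c _ (hpos N).le).comp hθ.continuous).aestronglyMeasurable.mul
        hEi.aestronglyMeasurable) hEi.norm
      (fun N => Eventually.of_forall fun x => ?_) (Eventually.of_forall fun x => ?_)
    · rw [norm_mul]
      exact mul_le_of_le_one_left (norm_nonneg _)
        (abs_deriv_div_one_add_mul_sq_le (hpos N).le (θ x))
    · have hc : ContinuousAt (fun ε => T' ε (θ x)) 0 := by
        refine ContinuousAt.div (by fun_prop) (by fun_prop) ?_
        simp
      have := (hc.tendsto.comp hlimε).mul_const (W x)
      simpa [hT'] using this
  refine tendsto_nhds_unique hl1 (hl2.neg.congr fun N => ?_)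
  rw [htr _ (hpos N) (hle N)]

end Flux

/-! ### Time derivatives of integrals on an interval -/

section TimeDerivative

/-- Differentiation under the integral sign for derivatives within an interval, one-sided at its
end points. The derivative is integrable since it is a limit of difference quotients, which are
dominated by the mean value inequality. -/
theorem integrable_and_hasDerivWithinAt_integral {α : Type*} [MeasurableSpace α] {μ : Measure α}
    {J : Set ℝ} (hJ : J.OrdConnected) {F F' : ℝ → α → ℝ} {t : ℝ} (ht : t ∈ J)
    (hac : UniqueDiffWithinAt ℝ J t)
    (hF : ∀ s ∈ J, Integrable (F s) μ)
    (hF' : ∀ s ∈ J, ∀ x, HasDerivWithinAt (fun r => F r x) (F' s x) J s)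
    {g : α → ℝ} (hg : Integrable g μ) (hb : ∀ᶠ s in 𝓝[J] t, ∀ x, |F' s x| ≤ g x) :
    Integrable (F' t) μ ∧
      HasDerivWithinAt (fun s => ∫ x, F s x ∂μ) (∫ x, F' t x ∂μ) J t := by
  have : (𝓝[J \ {t}] t).NeBot :=
    accPt_principal_iff_nhdsWithin.1 (uniqueDiffWithinAt_iff_accPt.1 hac)
  have hslope : ∀ x, Tendsto (fun s => slope (fun r => F r x) t s) (𝓝[J \ {t}] t)
      (𝓝 (F' t x)) := fun x => hasDerivWithinAt_iff_tendsto_slope.1 (hF' t ht x)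
  have hmeas : ∀ᶠ s in 𝓝[J \ {t}] t,
      AEStronglyMeasurable (fun x => slope (fun r => F r x) t s) μ := by
    filter_upwards [self_mem_nhdsWithin] with s hs
    have : (fun x => slope (fun r => F r x) t s) = fun x => (s - t)⁻¹ • (F s x - F t x) := by
      ext x; rw [slope_def_module]
    rw [this]
    exact (((hF s hs.1).sub (hF t ht)).smul (s - t)⁻¹).aestronglyMeasurable
  have hbound : ∀ᶠ s in 𝓝[J \ {t}] t, ∀ x, ‖slope (fun r => F r x) t s‖ ≤ g x := by
    obtain ⟨r, hr, hball⟩ := Metric.mem_nhdsWithin_iff.1 hb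
    have hconv : Convex ℝ (Metric.ball t r ∩ J) := (convex_ball t r).inter hJ.convex
    filter_upwards [self_mem_nhdsWithin,
      mem_nhdsWithin_of_mem_nhds (Metric.ball_mem_nhds t hr)] with s hs hsr x
    have hmv := hconv.norm_image_sub_le_of_norm_hasDerivWithin_le (f := fun r => F r x)
      (f' := fun r => F' r x) (C := g x)
      (fun z hz => (hF' z hz.2 x).mono inter_subset_right) (fun z hz => hball hz x)
      ⟨Metric.mem_ball_self hr, ht⟩ ⟨hsr, hs.1⟩
    have hne : 0 < ‖s - t‖ := norm_pos_iff.2 (sub_ne_zero.2 hs.2)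
    rw [slope_def_module, norm_smul, norm_inv, inv_mul_le_iff₀ hne, mul_comm]
    exact hmv
  have hm : AEStronglyMeasurable (F' t) μ := by
    obtain ⟨u, hu⟩ := exists_seq_tendsto (𝓝[J \ {t}] t)
    obtain ⟨N, hN⟩ := eventually_atTop.1 (hu.eventually hmeas)
    exact aestronglyMeasurable_of_tendsto_ae atTop (fun k => hN (k + N) (Nat.le_add_left N k))
      (Eventually.of_forall fun x => (hslope x).comp (hu.comp (tendsto_add_atTop_nat N)))
  refine ⟨hg.mono' hm (Eventually.of_forall fun x => hb.self_of_nhdsWithin ht x), ?_⟩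
  rw [hasDerivWithinAt_iff_tendsto_slope]
  refine (tendsto_integral_filter_of_dominated_convergence g hmeas
    (hbound.mono fun s hs => Eventually.of_forall hs) hg
    (Eventually.of_forall hslope)).congr' ?_
  filter_upwards [self_mem_nhdsWithin] with s hs
  simp only [slope_def_module]
  rw [integral_smul, integral_sub (hF s hs.1) (hF t ht)]

/-- Every number is a derivative within a set with at most one point. -/
theorem hasDerivWithinAt_of_subsingleton {J : Set ℝ} (hJ : J.Subsingleton) (f : ℝ → ℝ) (f' t : ℝ)
    (ht : t ∈ J) : HasDerivWithinAt f f' J t := by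
  rw [hasDerivWithinAt_iff_tendsto_slope, hJ.eq_singleton_of_mem ht]
  simp

theorem uniqueDiffOn_of_ordConnected {J : Set ℝ} (hJ : J.OrdConnected) (hn : J.Nontrivial) :
    UniqueDiffOn ℝ J :=
  uniqueDiffOn_convex hJ.convex (by
    obtain ⟨a, ha, b, hb, hab⟩ := hn.exists_lt
    exact (nonempty_Ioo.2 hab).mono
      (interior_maximal (Ioo_subset_Icc_self.trans (hJ.out ha hb)) isOpen_Ioo))

/-- If `a' = a b` with `a > 0`, then `b' = (H - a b²) / a` is the same equation as `a'' = H`. -/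
theorem hasDerivWithinAt_iff_second_order {J : Set ℝ} (hJ : J.OrdConnected) {H a b : ℝ → ℝ}
    (ha : ∀ t ∈ J, 0 < a t) (hab : ∀ t ∈ J, HasDerivWithinAt a (a t * b t) J t) :
    (∀ t ∈ J, HasDerivWithinAt b (1 / a t * (H t - a t * b t ^ 2)) J t) ↔
      (∀ t ∈ J, HasDerivWithinAt (derivWithin a J) (H t) J t) := by
  rcases J.subsingleton_or_nontrivial with hs | hn
  · exact iff_of_true (fun t ht => hasDerivWithinAt_of_subsingleton hs _ _ t ht)
      (fun t ht => hasDerivWithinAt_of_subsingleton hs _ _ t ht)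
  have hu := uniqueDiffOn_of_ordConnected hJ hn
  have hd : ∀ t ∈ J, derivWithin a J t = a t * b t := fun t ht =>
    (hab t ht).derivWithin (hu t ht)
  constructor
  · intro hb t ht
    have h := ((hab t ht).mul (hb t ht)).congr (f₁ := derivWithin a J) hd (hd t ht)
    refine h.congr_deriv ?_
    have := (ha t ht).ne'
    field_simp
    ring
  · intro h t ht
    have hq : ∀ s ∈ J, b s = derivWithin a J s / a s := fun s hs => by
      rw [hd s hs, mul_div_cancel_left₀ _ (ha s hs).ne']
    have h1 := ((h t ht).div (hab t ht) (ha t ht).ne').congr hq (hq t ht)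
    refine h1.congr_deriv ?_
    have := (ha t ht).ne'
    rw [hd t ht]
    field_simp

end TimeDerivative

/-! ### Mass and moment along a geodesic -/

section Conclusion

theorem SmoothVolume.measure_univ_ne_zero {n : ℕ} {M : Type*} [TopologicalSpace M]
    [ChartedSpace (EuclideanSpace ℝ (Fin n)) M] [MeasurableSpace M] [BorelSpace M]
    (μ : SmoothVolume n M) (p : M) : μ.measure univ ≠ 0 := by
  intro h
  have hT : IsOpen (extChartAt (𝓡 n) p).target := isOpen_extChartAt_target p
  have h1 : μ.measure (extChartAt (𝓡 n) p).source = 0 := measure_mono_null (subset_univ _) h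
  rw [μ.measure_eq p _ (isOpen_extChartAt_source p).measurableSet subset_rfl,
    (extChartAt (𝓡 n) p).image_source_eq_target,
    lintegral_eq_zero_iff' (aemeasurable_density μ p)] at h1
  have h2 : ∀ᵐ y ∂volume.restrict (extChartAt (𝓡 n) p).target, False := by
    filter_upwards [h1, ae_restrict_mem hT.measurableSet] with y hy hyT
    exact (ENNReal.ofReal_pos.2 (μ.density_pos p y hyT)).ne' hy
  rw [eventually_false_iff_eq_bot, ae_eq_bot, Measure.restrict_eq_zero] at h2
  exact (hT.measure_pos volume ⟨_, mem_extChartAt_target p⟩).ne' h2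

theorem totalMass_pos {n : ℕ} {M : Type*} [TopologicalSpace M]
    [ChartedSpace (EuclideanSpace ℝ (Fin n)) M] [MeasurableSpace M] [BorelSpace M] [Nonempty M]
    (μ : SmoothVolume n M) {ρ : M → ℝ} (hρ0 : ∀ x, 0 < ρ x) (hρi : Integrable ρ μ.measure) :
    0 < totalMass μ ρ := by
  rw [totalMass, integral_pos_iff_support_of_nonneg (fun x => (hρ0 x).le) hρi]
  have : Function.support ρ = univ := eq_univ_of_forall fun x => (hρ0 x).ne'
  rw [this]
  exact pos_iff_ne_zero.2 (μ.measure_univ_ne_zero (Classical.arbitrary M))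

variable {n : ℕ} {M : Type*} [EMetricSpace M]
    [ChartedSpace (EuclideanSpace ℝ (Fin n)) M] [IsManifold (𝓡 n) ∞ M]
    [RiemannianBundle (fun x : M => TangentSpace (𝓡 n) x)]
    [IsContMDiffRiemannianBundle (𝓡 n) ∞ (EuclideanSpace ℝ (Fin n))
      (fun x : M => TangentSpace (𝓡 n) x)]
    [IsRiemannianManifold (𝓡 n) M] [SecondCountableTopology M]
    [MeasurableSpace M] [BorelSpace M]

/-- Along a geodesic, `(∫ ρ)' = ξ ∫ ρ` and `(∫ θ ρ)' = ½ ∫ |∇θ|² ρ + ½ ξ² ∫ ρ`. -/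
theorem IsHamiltonianGeodesic.hasDerivWithinAt_mass_and_moment
    (hcomplete : ∀ (x : M) (r : ℝ≥0), IsCompact (Metric.closedEBall x (r : ℝ≥0∞)))
    {μ : SmoothVolume n M} {J : Set ℝ} (hJ : J.OrdConnected) (hu : UniqueDiffOn ℝ J)
    {ρ θ : ℝ → M → ℝ} (hsol : IsHamiltonianGeodesic μ J ρ θ) {t : ℝ} (ht : t ∈ J) :
    HasDerivWithinAt (fun s => totalMass μ (ρ s))
      (xiVar μ (ρ t) (θ t) * totalMass μ (ρ t)) J t ∧
    HasDerivWithinAt (fun s => ∫ x, θ s x * ρ s x ∂μ.measure)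
      (1 / 2 * ∫ x, ‖riemGrad (n := n) (θ t) x‖ ^ 2 * ρ t x ∂μ.measure +
        xiVar μ (ρ t) (θ t) ^ 2 / 2 * totalMass μ (ρ t)) J t := by
  obtain ⟨g, hg, hgb⟩ := hsol.dominated t ht
  set ξ := xiVar μ (ρ t) (θ t) with hξ
  -- the time derivatives, as derivatives within `J`
  have hρd : ∀ s ∈ J, ∀ x, HasDerivWithinAt (fun r => ρ r x)
      (derivWithin (fun r => ρ r x) J s) J s := fun s hs x =>
    (hsol.rho_eq s hs x x (mem_extChartAt_source x)).differentiableWithinAt.hasDerivWithinAt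
  have hθρd : ∀ s ∈ J, ∀ x, HasDerivWithinAt (fun r => θ r x * ρ r x)
      (derivWithin (fun r => θ r x * ρ r x) J s) J s := fun s hs x =>
    ((hsol.theta_eq s hs x).differentiableWithinAt.mul
      (hρd s hs x).differentiableWithinAt).hasDerivWithinAt
  obtain ⟨hρ'i, hm⟩ := integrable_and_hasDerivWithinAt_integral hJ ht (hu t ht)
    hsol.integrable_rho hρd hg (hgb.mono fun s hs x => (hs x).1)
  obtain ⟨hθρ'i, hN⟩ := integrable_and_hasDerivWithinAt_integral hJ ht (hu t ht)
    hsol.integrable_theta_rho hθρd hg (hgb.mono fun s hs x => (hs x).2)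
  have hρi := hsol.integrable_rho t ht
  have hEi := hsol.integrable_energy t ht
  -- the divergence of `ρ ∇θ` does not depend on the chart, since `∂ₜρ` does not
  set D : M → ℝ := fun x => ξ * ρ t x - derivWithin (fun r => ρ r x) J t with hD
  have hDdiv : ∀ p, ∀ x ∈ (extChartAt (𝓡 n) p).source,
      divergence μ p (fun z => ρ t z • riemGrad (n := n) (θ t) z) x = D x := by
    intro p x hx
    have := (hsol.rho_eq t ht p x hx).derivWithin (hu t ht)
    simp only [hD, this]
    ring
  have hDi : Integrable D μ.measure := (hρi.const_mul ξ).sub hρ'i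
  set E : M → ℝ := fun x => ‖riemGrad (n := n) (θ t) x‖ ^ 2 * ρ t x with hE
  have hθρ' : ∀ x, derivWithin (fun r => θ r x * ρ r x) J t =
      -(1 / 2) * E x + ξ ^ 2 / 2 * ρ t x - θ t x * D x := by
    intro x
    rw [((hsol.theta_eq t ht x).fun_mul (hρd t ht x)).derivWithin (hu t ht)]
    simp only [hD, hE]
    ring
  -- `θ D` is integrable, because `∂ₜ(θρ)` and all its other terms are
  have hθD : Integrable (fun x => θ t x * D x) μ.measure := by
    refine (((hEi.const_mul (-(1 / 2))).add (hρi.const_mul (ξ ^ 2 / 2))).sub hθρ'i).congr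
      (Eventually.of_forall fun x => ?_)
    simp only [Pi.sub_apply, Pi.add_apply, hθρ', hE]
    ring
  have hI1 := integral_divergence_smul_riemGrad hcomplete μ (hsol.contMDiff_rho t ht)
    (hsol.contMDiff_theta t ht) (hsol.rho_pos t ht) hρi hEi hDdiv hDi
  have hI2 := integral_mul_divergence_smul_riemGrad hcomplete μ (hsol.contMDiff_rho t ht)
    (hsol.contMDiff_theta t ht) (hsol.rho_pos t ht) hρi hEi hDdiv hDi hθD
  constructor
  · refine hm.congr_deriv ?_
    have : ∫ x, D x ∂μ.measure = ξ * totalMass μ (ρ t) -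
        ∫ x, derivWithin (fun r => ρ r x) J t ∂μ.measure := by
      rw [hD, integral_sub (hρi.const_mul ξ) hρ'i, integral_const_mul, totalMass]
    linarith
  · refine hN.congr_deriv ?_
    simp only [hθρ']
    have hsum : Integrable (fun x => -(1 / 2) * E x + ξ ^ 2 / 2 * ρ t x) μ.measure :=
      (hEi.const_mul _).add (hρi.const_mul _)
    rw [integral_sub hsum hθD, integral_add (hEi.const_mul _) (hρi.const_mul _), integral_const_mul,
      integral_const_mul,
      hI2, totalMass]
    ring

end Conclusion

theorem mainTheorem2 {n : ℕ} {M : Type*} [EMetricSpace M]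
    [ChartedSpace (EuclideanSpace ℝ (Fin n)) M] [IsManifold (𝓡 n) ∞ M]
    [RiemannianBundle (fun x : M => TangentSpace (𝓡 n) x)]
    [IsContMDiffRiemannianBundle (𝓡 n) ∞ (EuclideanSpace ℝ (Fin n))
      (fun x : M => TangentSpace (𝓡 n) x)]
    [IsRiemannianManifold (𝓡 n) M] [SecondCountableTopology M]
    [MeasurableSpace M] [BorelSpace M]
    (hcomplete : ∀ (x : M) (r : ℝ≥0), IsCompact (Metric.closedEBall x (r : ℝ≥0∞)))
    (μ : SmoothVolume n M) (J : Set ℝ) (hJ : J.OrdConnected)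
    (ρ θ : ℝ → M → ℝ) (hsol : IsHamiltonianGeodesic μ J ρ θ)
    (m ξ H : ℝ → ℝ) (hm : ∀ t, m t = totalMass μ (ρ t)) (hξ : ∀ t, ξ t = xiVar μ (ρ t) (θ t))
    (hH : ∀ t, H t = uotHamiltonian μ (ρ t) (θ t)) :
    (∀ t ∈ J, HasDerivWithinAt ξ (1 / m t * (H t - m t * ξ t ^ 2)) J t) ∧
    (∀ t ∈ J, HasDerivWithinAt m (m t * ξ t) J t) ∧
    (∀ t ∈ J, HasDerivWithinAt (derivWithin m J) (H t) J t) ∧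
    (∀ a b : ℝ → ℝ, (∀ t ∈ J, 0 < a t) → (∀ t ∈ J, HasDerivWithinAt a (a t * b t) J t) →
      ((∀ t ∈ J, HasDerivWithinAt b (1 / a t * (H t - a t * b t ^ 2)) J t) ↔
        (∀ t ∈ J, HasDerivWithinAt (derivWithin a J) (H t) J t))) := by
  rcases J.subsingleton_or_nontrivial with hs | hn
  · exact ⟨fun t ht => hasDerivWithinAt_of_subsingleton hs _ _ t ht,
      fun t ht => hasDerivWithinAt_of_subsingleton hs _ _ t ht,
      fun t ht => hasDerivWithinAt_of_subsingleton hs _ _ t ht,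
      fun a b ha hab => hasDerivWithinAt_iff_second_order hJ ha hab⟩
  have hu := uniqueDiffOn_of_ordConnected hJ hn
  set N : ℝ → ℝ := fun s => ∫ x, θ s x * ρ s x ∂μ.measure with hN
  have hξN : ∀ s, ξ s = N s / m s := fun s => by rw [hξ, hm, xiVar]
  -- for `M = ∅` all three quantities vanish
  have hmN : ∀ s ∈ J, m s * ξ s = N s := by
    intro s hs
    rcases isEmpty_or_nonempty M with hM | hM
    · simp [hξN, hN, Measure.eq_zero_of_isEmpty μ.measure]
    · rw [hξN, mul_div_cancel₀]
      rw [hm]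
      exact (totalMass_pos μ (hsol.rho_pos s hs) (hsol.integrable_rho s hs)).ne'
  have hm' : ∀ t ∈ J, HasDerivWithinAt m (m t * ξ t) J t := by
    intro t ht
    have h := (hsol.hasDerivWithinAt_mass_and_moment hcomplete hJ hu ht).1
    rw [← hξ, ← hm, mul_comm] at h
    exact h.congr (fun s _ => hm s) (hm t)
  have hN' : ∀ t ∈ J, HasDerivWithinAt N (H t) J t := by
    intro t ht
    refine (hsol.hasDerivWithinAt_mass_and_moment hcomplete hJ hu ht).2.congr_deriv ?_
    rw [hH, uotHamiltonian, ← hm, ← hξ]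
    change _ = _ + 1 / (2 * m t) * N t ^ 2
    rw [← hmN t ht]
    rcases eq_or_ne (m t) 0 with h0 | h0
    · simp [h0]
    · field_simp
  have hmd : ∀ t ∈ J, derivWithin m J t = N t := fun t ht => by
    rw [(hm' t ht).derivWithin (hu t ht), hmN t ht]
  refine ⟨fun t ht => ?_, hm', fun t ht => (hN' t ht).congr hmd (hmd t ht),
    fun a b ha hab => hasDerivWithinAt_iff_second_order hJ ha hab⟩
  rcases isEmpty_or_nonempty M with hM | hM
  · have h0 : ∀ s, m s = 0 := fun s => by
      rw [hm, totalMass, Measure.eq_zero_of_isEmpty μ.measure, integral_zero_measure]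
    have h1 : ξ = fun _ => 0 := funext fun s => by rw [hξN, h0, div_zero]
    rw [h0, h1]
    simpa using hasDerivWithinAt_const t J (0 : ℝ)
  · have h0 : m t ≠ 0 := by
      rw [hm]
      exact (totalMass_pos μ (hsol.rho_pos t ht) (hsol.integrable_rho t ht)).ne'
    have h := ((hN' t ht).div (hm' t ht) h0).congr (fun s _ => hξN s) (hξN t)
    refine h.congr_deriv ?_
    rw [← hmN t ht]
    field_simp
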